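/- Let $k$ be an algebraically closed field (for instance $k=\mathbb{C}$), let $n\ge 0$, and let $\mathbb{P}^n$ be projective $n$-space over $k$. Write $h^0(E)=\dim_k H^0(\mathbb{P}^n,E)$. For coherent sheaves $E,F$ on $\mathbb{P}^n$ let $\mathrm{ev}\colon H^0(E)\otimes\operatorname{Hom}(E,F)\to H^0(F)$ be the evaluation map. The pair $E,F$ is called *strongly Kronecker stable*, written $E<F$, if (a) $H^0(F)\neq 0$; (b) $\mathrm{ev}$ is surjective; and (c) for every subspace $0\neq V\subsetneq H^0(E)$, $$\frac{\dim \mathrm{ev}(V\otimes \operatorname{Hom}(E,F))}{h^0(F)}>\frac{\dim V}{h^0(E)}.$$ **Theorem.** Let $E_1,\dots,E_a$ and $F_1,\dots,F_b$ be coherent sheaves on $\mathbb{P}^n$ such that $E_i<F_j$ for all $i,j$. Let $s_1,\dots,s_a,t_1,\dots,t_b$ be nonnegative integers, and set $V_1=\bigoplus_{i=1}^a E_i^{s_i}$ and $V_2=\bigoplus_{j=1}^b F_j^{t_j}$. Assume that $$\max\{h^0(V_1),h^0(V_2)\}\ \ge\ \frac14\Bigl(\max_i h^0(E_i)\Bigr)\Bigl(\max_j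 h^0(F_j)\Bigr)\sum_{i=1}^a h^0(E_i)^2 .$$ Then for a general $M\in\operatorname{Hom}(V_1,V_2)$, that is, for every $M$ in some nonempty Zariski open subset of the vector space $\operatorname{Hom}(V_1,V_2)$, the induced map $H^0(V_1)\to H^0(V_2)$ has maximal rank, i.e. its rank is $\min\{h^0(V_1),h^0(V_2)\}$. (A maximum over an empty index set is read as $0$.) -/

import Mathlib

universe u

open CategoryTheory CategoryTheory.Limits AlgebraicGeometry

noncomputable section

namespace MaxRank

/-! ## Projective space -/

section ProjectiveSpace

attribute [local instance] MvPolynomial.gradedAlgebra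

/-- The projective space `ℙⁿ` over `k`, namely `Proj k[x₀, …, xₙ]` with the standard grading. -/
def PSpace (n : ℕ) (k : Type u) [Field k] : Scheme.{u} :=
  Proj (MvPolynomial.homogeneousSubmodule (Fin (n + 1)) k)

/-- The structure morphism `ℙⁿ ⟶ Spec k`. -/
def PSpace.toSpec (n : ℕ) (k : Type u) [Field k] : PSpace n k ⟶ Spec (CommRingCat.of k) :=
  Proj.toSpecZero (MvPolynomial.homogeneousSubmodule (Fin (n + 1)) k) ≫
    Spec.map (CommRingCat.ofHom
      (algebraMap k (MvPolynomial.homogeneousSubmodule (Fin (n + 1)) k 0)))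

end ProjectiveSpace

/-- The scalars `k → Γ(ℙⁿ, U)`, for an open set `U`, given by the structure morphism. -/
def PSpace.scalar (n : ℕ) (k : Type u) [Field k] (U : (PSpace n k).Opens) :
    k →+* Γ(PSpace n k, U) :=
  ((Scheme.ΓSpecIso (CommRingCat.of k)).inv ≫ (PSpace.toSpec n k).appTop ≫
    (PSpace n k).presheaf.map (homOfLE (le_top : U ≤ ⊤)).op).hom

variable {n : ℕ} {k : Type u} [Field k]

lemma PSpace.map_scalar {U V : (PSpace n k).Opens} (i : U ⟶ V) (c : k) :
    (PSpace n k).presheaf.map i.op (PSpace.scalar n k V c) = PSpace.scalar n k U c := by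
  simp only [PSpace.scalar, CommRingCat.hom_comp, RingHom.comp_apply]
  rw [← CommRingCat.comp_apply, ← Functor.map_comp]
  rfl

/-! ## The `k`-linear structure on sheaves of modules on `ℙⁿ` -/

/-- The sections `Γ(M, U)` as a vector space over `k`. -/
instance sectionsModule (M : (PSpace n k).Modules) (U : (PSpace n k).Opens) :
    Module k Γ(M, U) :=
  Module.compHom _ (PSpace.scalar n k U)

lemma smul_def (M : (PSpace n k).Modules) (U : (PSpace n k).Opens) (c : k) (x : Γ(M, U)) :
    c • x = PSpace.scalar n k U c • x := rfl

lemma app_smul {M N : (PSpace n k).Modules} (φ : M ⟶ N) (U : (PSpace n k).Opens) (c : k)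
    (x : Γ(M, U)) : φ.app U (c • x) = c • φ.app U x :=
  Scheme.Modules.Hom.app_smul φ _ x

lemma app_smul_comm (c : k) {M N : (PSpace n k).Modules} (φ : M ⟶ N) (U : (PSpace n k).Opens)
    (r : Γ(PSpace n k, U)) (x : Γ(M, U)) : c • φ.app U (r • x) = r • c • φ.app U x := by
  rw [Scheme.Modules.Hom.app_smul, smul_def, smul_def, smul_smul, smul_smul, mul_comm]

/-- The scalar multiple `c φ` of a morphism of sheaves of modules, acting on sections by
`x ↦ c φ(x)`. -/
def smulHom (c : k) {M N : (PSpace n k).Modules} (φ : M ⟶ N) : M ⟶ N :=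
  ⟨PresheafOfModules.homMk
    { app := fun U => AddCommGrpCat.ofHom
        ((DistribSMul.toAddMonoidHom Γ(N, U.unop) c).comp (φ.app U.unop).hom)
      naturality := by
        intro U V i
        ext x
        change c • (φ.app V.unop (M.presheaf.map i x)) =
          N.presheaf.map i (c • (φ.app U.unop x))
        have h1 : φ.app V.unop (M.presheaf.map i x) = N.presheaf.map i (φ.app U.unop x) :=
          ConcreteCategory.congr_hom (φ.mapPresheaf.naturality i) x
        have h2 := Scheme.Modules.map_smul N i.unop (PSpace.scalar n k U.unop c)
          (φ.app U.unop x)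
        rw [PSpace.map_scalar] at h2
        rw [h1]
        exact h2.symm }
    (by
      intro U r x
      exact app_smul_comm c φ U.unop r x)⟩

lemma smulHom_app (c : k) {M N : (PSpace n k).Modules} (φ : M ⟶ N) (U : (PSpace n k).Opens)
    (x : Γ(M, U)) : (smulHom c φ).app U x = c • φ.app U x := rfl

lemma hom_ext' {M N : (PSpace n k).Modules} {φ ψ : M ⟶ N}
    (h : ∀ (U : (PSpace n k).Opens) (x : Γ(M, U)), φ.app U x = ψ.app U x) : φ = ψ := by
  apply Scheme.Modules.hom_ext
  intro U
  ext x
  exact h U x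

/-- `Hom(M, N)` as a vector space over `k`. -/
instance homModule (M N : (PSpace n k).Modules) : Module k (M ⟶ N) where
  smul c φ := smulHom c φ
  one_smul φ := hom_ext' fun U x => one_smul k (φ.app U x)
  mul_smul c d φ := hom_ext' fun U x => mul_smul c d (φ.app U x)
  smul_zero c := hom_ext' fun U _ => smul_zero (A := Γ(N, U)) c
  smul_add c φ ψ := hom_ext' fun U x => smul_add c (φ.app U x) (ψ.app U x)
  add_smul c d φ := hom_ext' fun U x => add_smul c d (φ.app U x)
  zero_smul φ := hom_ext' fun U x => zero_smul k (φ.app U x)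

lemma smul_app (c : k) {M N : (PSpace n k).Modules} (φ : M ⟶ N) (U : (PSpace n k).Opens)
    (x : Γ(M, U)) : (c • φ).app U x = c • φ.app U x := rfl

/-- The category of sheaves of modules on `ℙⁿ` is `k`-linear. -/
instance modulesLinear : Linear k (PSpace n k).Modules where
  homModule := homModule
  smul_comp _ _ _ c φ ψ := hom_ext' fun U x => app_smul ψ U c (φ.app U x)
  comp_smul _ _ _ _ _ _ := rfl

/-! ## Coherent sheaves and global sections -/

/-- A sheaf of modules on `ℙⁿ` (a noetherian scheme) is coherent if it is quasi-coherent and of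
finite type. -/
def IsCoherent (M : (PSpace n k).Modules) : Prop :=
  SheafOfModules.IsQuasicoherent M ∧ SheafOfModules.IsFiniteType M

/-- The space of global sections `H⁰(M)`. -/
abbrev H0 (M : (PSpace n k).Modules) : Type u := Γ(M, ⊤)

/-- The map `H⁰(M) → H⁰(N)` induced by `φ : M ⟶ N`. -/
def H0.map {M N : (PSpace n k).Modules} (φ : M ⟶ N) : H0 M →ₗ[k] H0 N where
  toFun x := φ.app ⊤ x
  map_add' x y := map_add _ x y
  map_smul' c x := app_smul φ ⊤ c x

/-- The dimension of a vector space, as an element of `ℕ∞`. -/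
def vdim (k : Type u) [Field k] (W : Type u) [AddCommGroup W] [Module k W] : ℕ∞ :=
  Cardinal.toENat (Module.rank k W)

/-- `h⁰(M) = dim H⁰(M)`. -/
def h0 (M : (PSpace n k).Modules) : ℕ∞ := vdim k (H0 M)

/-! ## Strong Kronecker stability -/

/-- The bilinear evaluation `(v, φ) ↦ φ(v)`, from `H⁰(E) × Hom(E, F)` to `H⁰(F)`. -/
def ev (E F : (PSpace n k).Modules) : H0 E →ₗ[k] (E ⟶ F) →ₗ[k] H0 F :=
  LinearMap.mk₂ k (fun v φ => H0.map φ v)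
    (fun v w φ => map_add (H0.map φ) v w)
    (fun c v φ => map_smul (H0.map φ) c v)
    (fun _ _ _ => rfl)
    (fun _ _ _ => rfl)

/-- The relation `E < F`: the pair `E, F` is strongly Kronecker stable. In the last condition
`Submodule.map₂ (ev E F) V ⊤` is the image `ev(V ⊗ Hom(E, F))`, and the inequality
`dim ev(V ⊗ Hom(E, F)) / h⁰(F) > dim V / h⁰(E)` is written with the (nonzero) denominators
cleared. -/
structure StronglyKroneckerStable (E F : (PSpace n k).Modules) : Prop where
  h0_ne_zero : h0 F ≠ 0
  ev_surjective : Function.Surjective (TensorProduct.lift (ev E F))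
  dim_lt : ∀ V : Submodule k (H0 E), V ≠ ⊥ → V ≠ ⊤ →
    vdim k V * h0 F < vdim k (Submodule.map₂ (ev E F) V ⊤) * h0 E

/-! ## Maximal rank and general maps -/

/-- A linear map has maximal rank if its rank is the smaller of the dimensions of its source and
target. -/
def HasMaximalRank {W₁ W₂ : Type u} [AddCommGroup W₁] [Module k W₁] [AddCommGroup W₂]
    [Module k W₂] (f : W₁ →ₗ[k] W₂) : Prop :=
  vdim k (LinearMap.range f) = min (vdim k W₁) (vdim k W₂)

/-- The polynomial functions on a vector space: the algebra of functions generated by the linear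
forms. -/
def polynomialFunctions (k : Type u) [Field k] (W : Type u) [AddCommGroup W] [Module k W] :
    Subalgebra k (W → k) :=
  Algebra.adjoin k (Set.range fun l : Module.Dual k W => (l : W → k))

/-- A subset of a vector space is Zariski open if it is the complement of the common zero locus
of a set of polynomial functions. -/
def IsZariskiOpen (k : Type u) [Field k] {W : Type u} [AddCommGroup W] [Module k W]
    (U : Set W) : Prop :=
  ∃ S : Set (W → k), S ⊆ polynomialFunctions k W ∧ U = {w | ∀ f ∈ S, f w = 0}ᶜ

/-- A property holds for the general element of the vector space `W` if it holds on a nonempty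
Zariski open subset of `W`. -/
def HoldsForGeneral (k : Type u) [Field k] {W : Type u} [AddCommGroup W] [Module k W]
    (P : W → Prop) : Prop :=
  ∃ U : Set W, IsZariskiOpen k U ∧ U.Nonempty ∧ ∀ w ∈ U, P w

instance modulesHasFiniteBiproducts : HasFiniteBiproducts (PSpace n k).Modules :=
  Abelian.hasFiniteBiproducts

/-- The direct sum `⨁ᵢ Eᵢ^{sᵢ}`. -/
def sumOfPowers {a : ℕ} (E : Fin a → (PSpace n k).Modules) (s : Fin a → ℕ) :
    (PSpace n k).Modules :=
  ⨁ fun p : (i : Fin a) × Fin (s i) => E p.1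

end MaxRank

end

namespace MaxRank

open scoped Matrix

/-! ## Minors of matrices -/

/-! Injectivity and surjectivity on sections are detected by a nonvanishing determinant, so one good
matrix `M` suffices. It is found by a dimension count. Let `U₁`, `U₂` be the dimensions of the two
spaces of sections, `nᵢ = h⁰(Eᵢ)`, and let `q` run through the summands of the target.

Suppose `U₁ ≤ U₂`. If `M x = 0` with `x ≠ 0`, let `Kᵢ` be the span of the components of `x` in the
copies of `H⁰(Eᵢ)`, and `dᵢ = dim Kᵢ`. The choice of `K` has `∑ dᵢ(nᵢ - dᵢ)` parameters and that of
`x` has `∑ sᵢdᵢ` more, one of which is lost to scaling. On the other side, `M x = 0` imposes `∑ dim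
W_q` conditions on `M`, where `W_q = ∑ᵢ ev(Kᵢ ⊗ Hom(Eᵢ, F_q))`. Hence `∑ dᵢ(nᵢ - dᵢ) + ∑ sᵢdᵢ ≤ ∑
dim W_q` is enough. If `U₂ ≤ U₁`, the same count is made for functionals `y ≠ 0` with `y ∘ M = 0`,
where `Kᵢ` is the largest subspace such that `y` kills `ev(Kᵢ ⊗ Hom(Eᵢ, F_q))` for all `q`.

The inequality is `sum_mul_sub_add_min_le`. If `ρ` is the largest `dᵢ/nᵢ`, strict stability and
integrality give `dim W_q ≥ ρ h⁰(F_q) + 1/max nᵢ`, and the lower bound on `max U₁ U₂` makes these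
gains outweigh the Grassmannians, whose dimensions are at most `nᵢ²/4`. The case `Kᵢ = H⁰(Eᵢ)`, on
which stability is silent, is settled by surjectivity of `ev`.

Dimensions are counted as transcendence degrees (`exists_generic_solution`, `isThin_incidence`): the
incidence variety is covered by finitely many families, each specializing a generic point over a
domain of transcendence degree less than the number of coordinates of `M`. These coordinates then
satisfy a polynomial relation. Grassmannians enter through affine charts (`exists_chart`). -/

theorem exists_linearIndependent_col {k : Type*} [Field k] {m n : Type*} [Fintype m] [Fintype n]
    (A : Matrix m n k) {w : ℕ} (h : w ≤ A.rank) :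
    ∃ c : Fin w → n, LinearIndependent k (fun i => A.col (c i)) := by
  obtain ⟨κ, a, ha, hs, hl⟩ := exists_linearIndependent' k A.col
  have : Fintype κ := Fintype.ofInjective a ha
  rw [Matrix.rank_eq_finrank_span_cols, ← hs, finrank_span_eq_card hl] at h
  obtain ⟨f⟩ := Function.Embedding.nonempty_of_card_le (α := Fin w) (β := κ) (by simpa using h)
  exact ⟨a ∘ f, hl.comp f f.injective⟩

theorem exists_minor_ne_zero {k : Type*} [Field k] {m n : Type*} [Fintype m] [Fintype n]
    (A : Matrix m n k) {w : ℕ} (h : w ≤ A.rank) :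
    ∃ (r : Fin w → m) (c : Fin w → n), (A.submatrix r c).det ≠ 0 := by
  obtain ⟨c, hc⟩ := exists_linearIndependent_col A h
  have h1 : w ≤ (A.submatrix id c).transpose.rank := by
    have : LinearIndependent k (A.submatrix id c).col := hc
    rw [Matrix.rank_transpose, Matrix.rank_eq_finrank_span_cols, finrank_span_eq_card this]
    simp
  obtain ⟨r, hr⟩ := exists_linearIndependent_col _ h1
  refine ⟨r, c, ?_⟩
  have h2 : LinearIndependent k (A.submatrix r c).row := hr
  rw [Matrix.linearIndependent_rows_iff_isUnit, Matrix.isUnit_iff_isUnit_det] at h2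
  exact h2.ne_zero

/-! ## Generic solutions of linear systems -/

theorem trdeg_localizationAway_le {k R : Type*} [Field k] [CommRing R] [IsDomain R] [Algebra k R]
    {g : R} (hg : g ≠ 0) : Algebra.trdeg k (Localization.Away g) ≤ Algebra.trdeg k R := by
  have hM : Submonoid.powers g ≤ nonZeroDivisors R := powers_le_nonZeroDivisors_of_noZeroDivisors hg
  have hinj : Function.Injective (algebraMap R (Localization.Away g)) :=
    IsLocalization.injective _ hM
  have : IsDomain (Localization.Away g) := IsLocalization.isDomain_of_le_nonZeroDivisors _ hM
  have : FaithfulSMul R (Localization.Away g) := (faithfulSMul_iff_algebraMap_injective _ _).2 hinj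
  have : Algebra.IsAlgebraic R (Localization.Away g) :=
    IsLocalization.isAlgebraic (Localization.Away g) (Submonoid.powers g)
  rw [← trdeg_add_eq k R (A := Localization.Away g),
    trdeg_eq_zero (R := R) (A := Localization.Away g), add_zero]

/-- The rows `r` of a linear system, solved for the unknowns in the columns `c`. -/
theorem submatrix_mulVec_comp {R : Type*} [CommRing R] {ρ m : Type*} [Fintype m]
    (A : Matrix ρ m R) {w : ℕ} (r : Fin w → ρ) (c : Fin w → m) (hc : Function.Injective c)
    (z : m → R) [DecidablePred (· ∈ Set.range c)] :
    A.submatrix r c *ᵥ (z ∘ c) =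
      (A *ᵥ z - A *ᵥ fun l => if l ∈ Set.range c then 0 else z l) ∘ r := by
  classical
  ext i
  simp only [Matrix.mulVec, dotProduct, Function.comp, Pi.sub_apply, ← Finset.sum_sub_distrib,
    Matrix.submatrix_apply]
  rw [← Finset.sum_image (s := Finset.univ) (g := c) (f := fun l => A (r i) l * z l) hc.injOn]
  rw [← Finset.sum_subset (Finset.subset_univ (Finset.univ.image c))]
  · refine Finset.sum_congr rfl fun l hl => ?_
    rw [if_pos (by simpa using hl), mul_zero, sub_zero]
  · intro l _ hl
    rw [if_neg (by simpa using hl), sub_self]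

theorem injective_of_submatrix_det_ne_zero {R : Type*} [CommRing R] {ρ m : Type*}
    {A : Matrix ρ m R} {w : ℕ} {r : Fin w → ρ} {c : Fin w → m}
    (h : (A.submatrix r c).det ≠ 0) : Function.Injective c := by
  intro i j hij
  by_contra hne
  exact h (Matrix.det_zero_of_column_eq hne fun l => by simp [hij])

open Classical in
/-- The solution of the system `A z = b` with prescribed values `v l` for `l` not in the image of
`c`, when `γ` is the inverse of the minor with rows `r` and columns `c`. -/
noncomputable def cramerSolution {R : Type*} [CommRing R] {ρ m : Type*} [Fintype m]
    (A : Matrix ρ m R) (b : ρ → R) {w : ℕ} (r : Fin w → ρ) (c : Fin w → m) (γ : R) (v : m → R)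
    (l : m) : R :=
  if h : l ∈ Set.range c then
    γ * ((A.submatrix r c).adjugate *ᵥ
      ((b - A *ᵥ fun l => if l ∈ Set.range c then 0 else v l) ∘ r)) h.choose
  else v l

theorem map_cramerSolution {R S : Type*} [CommRing R] [CommRing S] (f : R →+* S) {ρ m : Type*}
    [Fintype m] (A : Matrix ρ m R) (b : ρ → R) {w : ℕ} (r : Fin w → ρ) (c : Fin w → m) (γ : R)
    (v : m → R) (l : m) :
    f (cramerSolution A b r c γ v l) = cramerSolution (A.map f) (f ∘ b) r c (f γ) (f ∘ v) l := by
  unfold cramerSolution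
  split_ifs with h
  · rw [map_mul, RingHom.map_mulVec]
    congr 3
    · exact RingHom.map_adjugate f _
    · ext j
      simp only [Function.comp, Pi.sub_apply, map_sub, RingHom.map_mulVec]
      congr 3
      ext l
      simp only [Function.comp]
      split_ifs <;> simp
  · rfl

/-- Cramer's rule: the rows `r` determine the unknowns in the columns `c` from the free ones, so a
solution is recovered from its free coordinates. -/
theorem cramerSolution_eq {R : Type*} [CommRing R] {ρ m : Type*} [Fintype m] (A : Matrix ρ m R)
    {w : ℕ} (r : Fin w → ρ) (c : Fin w → m) (hc : Function.Injective c) {γ : R}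
    (hγ : γ * (A.submatrix r c).det = 1) {v z : m → R} (hv : ∀ l ∉ Set.range c, v l = z l) :
    cramerSolution A (A *ᵥ z) r c γ v = z := by
  classical
  ext l
  unfold cramerSolution
  split_ifs with h
  · have h1 : (fun l => if l ∈ Set.range c then 0 else v l) =
        fun l => if l ∈ Set.range c then 0 else z l := by
      ext l
      split_ifs with hl
      · rfl
      · exact hv l hl
    have h2 := submatrix_mulVec_comp A r c hc z
    have h3 : (A.submatrix r c).adjugate *ᵥ
        ((A *ᵥ z - A *ᵥ fun l => if l ∈ Set.range c then 0 else z l) ∘ r) =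
        (A.submatrix r c).det • (z ∘ c) := by
      rw [← h2, Matrix.mulVec_mulVec, Matrix.adjugate_mul, Matrix.smul_mulVec, Matrix.one_mulVec]
    have h4 := congrFun h3 h.choose
    convert congrArg (γ * ·) h4 using 1
    · congr!
    · simp only [Pi.smul_apply, Function.comp, smul_eq_mul, h.choose_spec]
      rw [← mul_assoc, hγ, one_mul]
  · exact hv l h

/-- The generic solution of the linear system `A z = b` over a domain `R`, on the locus where a
given minor of size `w` does not vanish: it lives over a domain of transcendence degree at most
`trdeg R + m - w`. -/
theorem exists_generic_solution {k R : Type u} [Field k] [CommRing R] [IsDomain R] [Algebra k R]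
    {ρ m : Type} [Fintype m] (A : Matrix ρ m R) (b : ρ → R) {w : ℕ} (r : Fin w → ρ)
    (c : Fin w → m) (hg : (A.submatrix r c).det ≠ 0) :
    ∃ (R' : Type u) (_ : CommRing R') (_ : IsDomain R') (_ : Algebra k R') (ψ : R →ₐ[k] R')
      (ζ : m → R'), Algebra.trdeg k R' + w ≤ Algebra.trdeg k R + Fintype.card m ∧
      ∀ (φ : R →ₐ[k] k) (z : m → k), A.map φ *ᵥ z = φ ∘ b → φ (A.submatrix r c).det ≠ 0 →
        ∃ φ' : R' →ₐ[k] k, φ'.comp ψ = φ ∧ φ' ∘ ζ = z := by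
  classical
  have hc := injective_of_submatrix_det_ne_zero hg
  set g := (A.submatrix r c).det with hgdef
  have hM : Submonoid.powers g ≤ nonZeroDivisors R := powers_le_nonZeroDivisors_of_noZeroDivisors hg
  have : IsDomain (Localization.Away g) := IsLocalization.isDomain_of_le_nonZeroDivisors _ hM
  -- The minor is inverted in `S`, and the unknowns outside the columns `c` become polynomial
  -- variables.
  let S := Localization.Away g
  let σ := {l : m // l ∉ Set.range c}
  let ψ₀ : R →ₐ[k] S := IsScalarTower.toAlgHom k R S
  let ψ : R →ₐ[k] MvPolynomial σ S := (IsScalarTower.toAlgHom k S (MvPolynomial σ S)).comp ψ₀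
  let v : m → MvPolynomial σ S := fun l =>
    if h : l ∈ Set.range c then 0 else MvPolynomial.X ⟨l, h⟩
  let γ : S := IsLocalization.Away.invSelf g
  refine ⟨MvPolynomial σ S, inferInstance, inferInstance, inferInstance, ψ,
    cramerSolution (A.map ψ) (ψ ∘ b) r c (MvPolynomial.C γ) v, ?_, ?_⟩
  · have h1 : Algebra.trdeg k (MvPolynomial σ S) = Algebra.trdeg k S + Fintype.card σ := by
      rw [← trdeg_add_eq k S (A := MvPolynomial σ S), MvPolynomial.trdeg_of_isDomain]
      simp
    have h2 : Fintype.card σ + w = Fintype.card m := by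
      have h3 := Fintype.card_subtype_compl (· ∈ Set.range c)
      have h4 : Fintype.card {l // l ∈ Set.range c} = w := by
        rw [← Fintype.card_congr (Equiv.ofInjective c hc), Fintype.card_fin]
      have h5 : Fintype.card {l // l ∈ Set.range c} ≤ Fintype.card m := Fintype.card_subtype_le _
      change Fintype.card {l : m // ¬ l ∈ Set.range c} + w = _
      omega
    rw [h1, ← h2, add_assoc]
    push_cast
    gcongr
    exact trdeg_localizationAway_le hg
  · intro φ z hz hφ
    -- A point with nonzero minor extends to `S`; sending the variables to the free coordinates of
    -- `z` forces the other coordinates by Cramer's rule.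
    have hu : ∀ s : Submonoid.powers g, IsUnit (φ s) := by
      rintro ⟨_, n, rfl⟩
      simpa using (IsUnit.mk0 _ hφ).pow n
    obtain ⟨φ₀, hφ₀⟩ : ∃ φ₀ : S →ₐ[k] k, ∀ x, φ₀ (ψ₀ x) = φ x :=
      ⟨IsLocalization.liftAlgHom (M := Submonoid.powers g) (f := φ) hu,
        fun x => IsLocalization.lift_eq _ _⟩
    obtain ⟨φ', hC, hX⟩ : ∃ φ' : MvPolynomial σ S →ₐ[k] k,
        (∀ x, φ' (MvPolynomial.C x) = φ₀ x) ∧ ∀ l, φ' (MvPolynomial.X l) = z l :=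
      ⟨{ MvPolynomial.eval₂Hom (φ₀ : S →+* k) (fun l : σ => z l) with
          commutes' := fun x => by
            change MvPolynomial.eval₂Hom (φ₀ : S →+* k) (fun l : σ => z l)
              (algebraMap k (MvPolynomial σ S) x) = x
            rw [IsScalarTower.algebraMap_apply k S (MvPolynomial σ S),
              MvPolynomial.algebraMap_eq, MvPolynomial.eval₂Hom_C]
            exact φ₀.commutes x },
        fun x => MvPolynomial.eval₂Hom_C _ _ _, fun l => MvPolynomial.eval₂Hom_X' _ _ _⟩
    have hψ : ∀ x, φ' (ψ x) = φ x := fun x => (hC _).trans (hφ₀ x)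
    refine ⟨φ', AlgHom.ext hψ, ?_⟩
    have hA : (A.map ψ).map φ' = A.map φ := Matrix.ext fun i j => hψ _
    have hb : φ' ∘ (ψ ∘ b) = φ ∘ b := funext fun j => hψ _
    have hdet : ((A.map φ).submatrix r c).det = φ g := (AlgHom.map_det φ _).symm
    have hγ : φ' (MvPolynomial.C γ) * ((A.map φ).submatrix r c).det = 1 := by
      rw [hC, hdet, ← hφ₀, ← map_mul, mul_comm]
      change φ₀ (algebraMap R S g * _) = 1
      rw [IsLocalization.Away.mul_invSelf, map_one]
    have hv : ∀ l ∉ Set.range c, (φ' ∘ v) l = z l := fun l hl => by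
      have h1 : v l = MvPolynomial.X ⟨l, hl⟩ := dif_neg hl
      rw [Function.comp, h1, hX]
    rw [← cramerSolution_eq (A.map φ) r c hc hγ hv, hz, ← hA, ← hb]
    exact funext fun l => map_cramerSolution (φ' : MvPolynomial σ S →+* k) _ _ r c _ v l

/-! ## A dimension count for incidence varieties -/

/-- The matrix `∑ l, x l • T l`. -/
def linComb {R : Type*} [CommRing R] {m ρ N : Type*} [Fintype m] (T : m → Matrix ρ N R)
    (x : m → R) : Matrix ρ N R :=
  Matrix.of fun i j => ∑ l, x l * T l i j

/-- Solving generically for `x` over `k[u]`, then for `y` over the ring of the generic `x`, gives a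
domain of transcendence degree at most `|ι| + |m| - w₁ + |N| - w₂ < |N|`. The coordinates of the
generic `y` are thus algebraically dependent, and the relation specializes to every point. If a
minor vanishes identically the locus is empty and `P = 1` serves. -/
theorem exists_polynomial_of_minors {k : Type u} [Field k] {ι m N ρ₁ ρ₂ : Type} [Fintype ι]
    [Fintype m] [Fintype N] (A : Matrix ρ₁ m (MvPolynomial ι k)) (b : ρ₁ → MvPolynomial ι k)
    (T : m → Matrix ρ₂ N k) {w₁ w₂ : ℕ} (hw : Fintype.card ι + Fintype.card m < w₁ + w₂)
    (r₁ : Fin w₁ → ρ₁) (c₁ : Fin w₁ → m) (r₂ : Fin w₂ → ρ₂) (c₂ : Fin w₂ → N) :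
    ∃ P : MvPolynomial N k, P ≠ 0 ∧ ∀ (u : ι → k) (x : m → k) (y : N → k),
      A.map (MvPolynomial.aeval u) *ᵥ x = MvPolynomial.aeval u ∘ b →
      ((A.map (MvPolynomial.aeval u)).submatrix r₁ c₁).det ≠ 0 →
      linComb T x *ᵥ y = 0 → ((linComb T x).submatrix r₂ c₂).det ≠ 0 →
      MvPolynomial.aeval y P = 0 := by
  by_cases hg₁ : (A.submatrix r₁ c₁).det = 0
  · refine ⟨1, one_ne_zero, fun u x y _ h _ _ => (h ?_).elim⟩
    have h1 := AlgHom.map_det (MvPolynomial.aeval u : MvPolynomial ι k →ₐ[k] k)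
      (A.submatrix r₁ c₁)
    rw [hg₁, map_zero] at h1
    exact h1.symm
  obtain ⟨R, _, _, _, ψ₁, ξ, htr₁, hlift₁⟩ := exists_generic_solution (k := k) A b r₁ c₁ hg₁
  let B : Matrix ρ₂ N R := linComb (fun l => (T l).map (algebraMap k R)) ξ
  have hB : ∀ (φ : R →ₐ[k] k) (x : m → k), φ ∘ ξ = x → B.map φ = linComb T x := by
    rintro φ _ rfl
    ext i j
    simp [B, linComb]
  by_cases hg₂ : (B.submatrix r₂ c₂).det = 0
  · refine ⟨1, one_ne_zero, fun u x y hx h1 _ h2 => (h2 ?_).elim⟩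
    obtain ⟨φ, -, hφ⟩ := hlift₁ (MvPolynomial.aeval u) x hx (by
      rwa [AlgHom.map_det])
    have h1 := AlgHom.map_det φ (B.submatrix r₂ c₂)
    rw [hg₂, map_zero] at h1
    rw [← hB φ x hφ]
    exact h1.symm
  obtain ⟨S, _, _, _, ψ₂, η, htr₂, hlift₂⟩ := exists_generic_solution (k := k) B 0 r₂ c₂ hg₂
  have hdep : ¬ AlgebraicIndependent k η := by
    intro h
    have h1 := h.lift_cardinalMk_le_trdeg
    rw [MvPolynomial.trdeg_of_isDomain] at htr₁
    simp only [Cardinal.mk_fintype, Cardinal.lift_natCast] at h1 htr₁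
    have h2 : ((Fintype.card N + w₂ + w₁ : ℕ) : Cardinal.{u}) ≤
        (Fintype.card ι + Fintype.card m + Fintype.card N : ℕ) := by
      push_cast
      calc (Fintype.card N + w₂ + w₁ : Cardinal.{u}) ≤ Algebra.trdeg k S + w₂ + w₁ := by
            gcongr
            simpa using h1
        _ ≤ Algebra.trdeg k R + Fintype.card N + w₁ := by gcongr
        _ = Algebra.trdeg k R + w₁ + Fintype.card N := add_right_comm _ _ _
        _ ≤ _ := by gcongr
    have h3 := Nat.cast_le.1 h2
    omega
  rw [algebraicIndependent_iff] at hdep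
  push Not at hdep
  obtain ⟨P, hP, hP0⟩ := hdep
  refine ⟨P, hP0, fun u x y hx h1 hy h2 => ?_⟩
  obtain ⟨φ, -, hφ⟩ := hlift₁ (MvPolynomial.aeval u) x hx (by rwa [AlgHom.map_det])
  obtain ⟨φ', -, hφ'⟩ := hlift₂ φ y (by
    rw [hB φ x hφ, hy]
    ext
    simp) (by
      rw [← hB φ x hφ] at h2
      rwa [AlgHom.map_det])
  rw [← hφ']
  have h3 := congrArg φ' hP
  rw [map_zero, ← AlgHom.comp_apply, MvPolynomial.comp_aeval] at h3
  exact h3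

/-- A subset of a finite-dimensional vector space is thin if it lies in the zero locus of a nonzero
polynomial. -/
def IsThin (k : Type*) [Field k] {Y : Type*} [AddCommGroup Y] [Module k Y] [FiniteDimensional k Y]
    (S : Set Y) : Prop :=
  ∃ P : MvPolynomial (Fin (Module.finrank k Y)) k, P ≠ 0 ∧
    ∀ y ∈ S, MvPolynomial.aeval ((Module.finBasis k Y).repr y) P = 0

section IsThin

variable {k : Type*} [Field k] {Y : Type*} [AddCommGroup Y] [Module k Y] [FiniteDimensional k Y]

theorem IsThin.mono {S T : Set Y} (hT : IsThin k T) (h : S ⊆ T) : IsThin k S :=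
  let ⟨P, hP, h0⟩ := hT
  ⟨P, hP, fun y hy => h0 y (h hy)⟩

theorem IsThin.iUnion {κ : Type*} [Finite κ] {S : κ → Set Y} (h : ∀ i, IsThin k (S i)) :
    IsThin k (⋃ i, S i) := by
  cases nonempty_fintype κ
  choose P hP h0 using h
  refine ⟨∏ i, P i, Finset.prod_ne_zero_iff.2 fun i _ => hP i, fun y hy => ?_⟩
  obtain ⟨i, hi⟩ := Set.mem_iUnion.1 hy
  rw [map_prod]
  exact Finset.prod_eq_zero (Finset.mem_univ i) (h0 i y hi)

theorem IsThin.exists_notMem [Infinite k] {S : Set Y} (h : IsThin k S) : ∃ y, y ∉ S := by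
  obtain ⟨P, hP, h0⟩ := h
  by_contra! hS
  refine hP (MvPolynomial.funext fun c => ?_)
  have h1 := h0 ((Module.finBasis k Y).equivFun.symm c) (hS _)
  rw [← Module.Basis.equivFun_apply, LinearEquiv.apply_symm_apply, MvPolynomial.aeval_eq_eval] at h1
  simpa using h1

end IsThin

/-- Dimension count for an incidence variety. The vectors `x` run through a family of linear
subspaces `A u x = 0` of codimension at least `w₁`, with a polynomial dependence on the parameters
`u`, and each `x` imposes at least `w₂` linear conditions `C x y = 0` on `y`. -/
theorem isThin_incidence {k : Type u} [Field k] {ι ρ : Type} [Fintype ι] [Finite ρ]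
    {X Y Z : Type*} [AddCommGroup X] [Module k X] [FiniteDimensional k X]
    [AddCommGroup Y] [Module k Y] [FiniteDimensional k Y]
    [AddCommGroup Z] [Module k Z] [FiniteDimensional k Z]
    (A : (ι → k) → X →ₗ[k] (ρ → k))
    (hA : ∀ x r, ∃ p : MvPolynomial ι k, ∀ u, MvPolynomial.aeval u p = A u x r)
    (C : X →ₗ[k] Y →ₗ[k] Z) {w₁ w₂ : ℕ}
    (hw : Fintype.card ι + Module.finrank k X ≤ w₁ + w₂) :
    IsThin k {y : Y | ∃ u x, x ≠ 0 ∧ A u x = 0 ∧ w₁ ≤ Module.finrank k (LinearMap.range (A u)) ∧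
      C x y = 0 ∧ w₂ ≤ Module.finrank k (LinearMap.range (C x))} := by
  classical
  have := Fintype.ofFinite ρ
  let bX := Module.finBasis k X
  let bY := Module.finBasis k Y
  let bZ := Module.finBasis k Z
  choose p hp using hA
  -- The row `none` is the normalization `x l₀ = 1`. It removes the scaling of `x` and supplies the
  -- strict inequality needed in the count.
  let A' : Fin (Module.finrank k X) → Matrix (Option ρ) (Fin (Module.finrank k X))
      (MvPolynomial ι k) := fun l₀ => Matrix.of fun r l =>
    r.elim (if l = l₀ then 1 else 0) (p (bX l))
  let b' : Option ρ → MvPolynomial ι k := fun r => r.elim 1 0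
  let T : Fin (Module.finrank k X) →
      Matrix (Fin (Module.finrank k Z)) (Fin (Module.finrank k Y)) k :=
    fun l => LinearMap.toMatrix bY bZ (C (bX l))
  have key := fun l₀ r₁ c₁ r₂ c₂ => exists_polynomial_of_minors (A' l₀) b' T
    (w₁ := w₁ + 1) (w₂ := w₂) (by simpa using by omega) r₁ c₁ r₂ c₂
  choose P hP hP0 using key
  -- The polynomial depends only on a nonzero coordinate of `x` and on the positions of two nonzero
  -- minors, so finitely many polynomials suffice.
  refine IsThin.mono (T := ⋃ i : Fin (Module.finrank k X) × (Fin (w₁ + 1) → Option ρ) ×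
      (Fin (w₁ + 1) → Fin (Module.finrank k X)) × (Fin w₂ → Fin (Module.finrank k Z)) ×
      (Fin w₂ → Fin (Module.finrank k Y)),
    {y | MvPolynomial.aeval (bY.repr y) (P i.1 i.2.1 i.2.2.1 i.2.2.2.1 i.2.2.2.2) = 0})
    (IsThin.iUnion fun i => ⟨_, hP _ _ _ _ _, fun y hy => hy⟩) ?_
  rintro y ⟨u, x, hx, hAx, hA, hC, hCr⟩
  obtain ⟨l₀, hl₀⟩ : ∃ l, bX.repr x l ≠ 0 := by
    by_contra! h
    exact hx (bX.repr.map_eq_zero_iff.1 (Finsupp.ext h))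
  let a := bX.repr x l₀
  have ha : a ≠ 0 := hl₀
  let x' := a⁻¹ • x
  have hlin : linComb T (bX.repr x') = LinearMap.toMatrix bY bZ (C x') := by
    conv_rhs => rw [← bX.sum_repr x']
    ext i j
    simp [-Module.Basis.sum_repr, linComb, T, LinearMap.toMatrix_apply]
  let L : X →ₗ[k] (Option ρ → k) :=
    LinearMap.pi fun r => r.elim (bX.coord l₀) (fun r => LinearMap.proj r ∘ₗ A u)
  have hL : (A' l₀).map (MvPolynomial.aeval u) = LinearMap.toMatrix bX (Pi.basisFun k _) L := by
    ext r l
    cases r with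
    | none => simp [A', L, LinearMap.toMatrix_apply, Finsupp.single_apply, apply_ite]
    | some r => simpa [A', L, LinearMap.toMatrix_apply] using hp (bX l) r u
  -- Since `x` lies in the kernel of `A u` and has `l₀`-th coordinate nonzero, the normalizing row
  -- raises the rank to at least `w₁ + 1`.
  have hker : LinearMap.ker L < LinearMap.ker (A u) := by
    refine SetLike.lt_iff_le_and_exists.2 ⟨fun z hz => ?_, x, hAx, fun h => hl₀ ?_⟩
    · exact funext fun r => congrFun (LinearMap.mem_ker.1 hz) (some r)
    · exact congrFun (LinearMap.mem_ker.1 h) none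
  have hLr : w₁ + 1 ≤ ((A' l₀).map (MvPolynomial.aeval u : MvPolynomial ι k →ₐ[k] k)).rank := by
    rw [hL, Matrix.rank_eq_finrank_range_toLin _ (Pi.basisFun k _) bX, Matrix.toLin_toMatrix]
    have h1 := Submodule.finrank_lt_finrank_of_lt hker
    have h2 := L.finrank_range_add_finrank_ker
    have h3 := (A u).finrank_range_add_finrank_ker
    omega
  have hCr' : w₂ ≤ (linComb T (bX.repr x')).rank := by
    rw [hlin, Matrix.rank_eq_finrank_range_toLin _ bZ bY, Matrix.toLin_toMatrix, map_smul,
      LinearMap.range_smul _ _ (inv_ne_zero ha)]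
    exact hCr
  obtain ⟨r₁, c₁, h₁⟩ := exists_minor_ne_zero _ hLr
  obtain ⟨r₂, c₂, h₂⟩ := exists_minor_ne_zero _ hCr'
  refine Set.mem_iUnion.2 ⟨⟨l₀, r₁, c₁, r₂, c₂⟩, ?_⟩
  refine hP0 l₀ r₁ c₁ r₂ c₂ u (bX.repr x') (bY.repr y) ?_ h₁ ?_ h₂
  · rw [hL, LinearMap.toMatrix_mulVec_repr]
    ext r
    cases r with
    | none => simp [L, b', x', a, inv_mul_cancel₀ hl₀]
    | some r => simp [L, b', x', hAx]
  · rw [hlin, LinearMap.toMatrix_mulVec_repr]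
    simp [x', hC]

/-! ## Charts of Grassmannians -/

/-- Every subspace is a graph over a coordinate subspace. -/
theorem exists_chart {k V : Type*} [Field k] [AddCommGroup V] [Module k V] {κ : Type*} [Fintype κ]
    [DecidableEq κ] (b : Module.Basis κ k V) (K : Submodule k V) :
    ∃ (D : Finset κ) (u : {c // c ∉ D} → {j // j ∈ D} → k),
      D.card + Module.finrank k K = Fintype.card κ ∧
      (∀ x ∈ K, ∀ j : {j // j ∈ D}, b.repr x j = ∑ c, u c j * b.repr x c) ∧
      K = Submodule.span k (Set.range fun c : {c // c ∉ D} => b c + ∑ j, u c j • b j) := by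
  classical
  have : FiniteDimensional k V := b.finiteDimensional_of_finite
  -- `D` indexes basis vectors whose classes form a basis of `V ⧸ K`; `u` holds the negated
  -- coordinates of the other classes.
  obtain ⟨D', -, -, hspan, hli⟩ := exists_linearIndepOn_extension (K := k)
    (v := fun l => K.mkQ (b l)) (linearIndepOn_empty k _) (Set.empty_subset Set.univ)
  let D : Finset κ := D'.toFinset
  have hD : ∀ l, l ∈ D ↔ l ∈ D' := fun l => Set.mem_toFinset
  have hli' : LinearIndependent k fun l : {l // l ∈ D} => K.mkQ (b l) :=
    hli.comp (fun l : {l // l ∈ D} => (⟨l, (hD l).1 l.2⟩ : D'))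
      fun _ _ h => Subtype.ext (congrArg (fun l : D' => (l : κ)) h)
  have htop : ⊤ ≤ Submodule.span k (Set.range fun l : {l // l ∈ D} => K.mkQ (b l)) := by
    have h1 : (Set.range fun l : {l // l ∈ D} => K.mkQ (b l)) = (fun l => K.mkQ (b l)) '' D' := by
      ext x
      simp [hD]
    rw [h1]
    calc ⊤ = Submodule.map K.mkQ ⊤ := by rw [Submodule.map_top, Submodule.range_mkQ]
      _ = Submodule.span k ((fun l => K.mkQ (b l)) '' Set.univ) := by
        rw [← b.span_eq, Submodule.map_span, ← Set.range_comp, Set.image_univ]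
        rfl
      _ ≤ _ := Submodule.span_le.2 hspan
  let B : Module.Basis {l // l ∈ D} k (V ⧸ K) := Module.Basis.mk hli' htop
  have hB : ∀ l, B l = K.mkQ (b l) := fun l => Module.Basis.mk_apply _ _ _
  let u : {c // c ∉ D} → {j // j ∈ D} → k := fun c j => -B.repr (K.mkQ (b c)) j
  have hq : ∀ c : {c // c ∉ D}, b c + ∑ j, u c j • b j ∈ K := fun c => by
    rw [← Submodule.ker_mkQ K, LinearMap.mem_ker, map_add, map_sum]
    simp only [map_smul, ← hB]
    simp only [u, neg_smul, Finset.sum_neg_distrib, B.sum_repr, add_neg_cancel]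
  have hK : ∀ x ∈ K, ∀ j : {j // j ∈ D}, b.repr x j = ∑ c, u c j * b.repr x c := by
    intro x hx j
    have h1 : B.repr (K.mkQ x) j = 0 := by
      rw [(LinearMap.mem_ker (f := K.mkQ)).1 (by rwa [Submodule.ker_mkQ])]
      simp
    rw [← b.sum_repr x, ← Fintype.sum_subtype_add_sum_subtype (· ∈ D)] at h1
    simp only [map_add, map_sum, map_smul, ← hB, B.repr_self, Finsupp.add_apply,
      Finsupp.finsetSum_apply, Finsupp.smul_apply, Finsupp.single_apply, smul_eq_mul] at h1
    simp only [mul_ite, mul_one, mul_zero, Finset.sum_ite_eq', Finset.mem_univ, if_true] at h1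
    rw [eq_neg_of_add_eq_zero_left h1, ← Finset.sum_neg_distrib]
    exact Finset.sum_congr rfl fun c _ => by simp only [u]; ring
  refine ⟨D, u, ?_, hK, le_antisymm (fun x hx => ?_) ?_⟩
  · have h1 := Module.finrank_eq_card_basis B
    have h2 := K.finrank_quotient_add_finrank
    rw [h1, Module.finrank_eq_card_basis b, Fintype.card_coe] at h2
    exact h2
  · have h1 : x = ∑ c : {c // c ∉ D}, b.repr x c • (b c + ∑ j, u c j • b j) := by
      conv_lhs => rw [← b.sum_repr x, ← Fintype.sum_subtype_add_sum_subtype (· ∈ D)]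
      simp only [smul_add, Finset.sum_add_distrib, Finset.smul_sum, hK x hx, Finset.sum_smul]
      rw [add_comm, Finset.sum_comm]
      congr 1
      refine Finset.sum_congr (by ext; simp) fun c _ =>
        Finset.sum_congr (by ext; simp) fun j _ => ?_
      rw [smul_smul, mul_comm]
    rw [h1]
    exact Submodule.sum_mem _ fun c _ => Submodule.smul_mem _ _ (Submodule.subset_span ⟨c, rfl⟩)
  · rw [Submodule.span_le]
    rintro _ ⟨c, rfl⟩
    exact hq c

/-! ## General Kronecker maps -/

/-- The rows of `y` vary independently, so the range of `Φ` contains the product of the sums of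
ranges. This bounds below the number of conditions that `M x = 0` or `y ∘ M = 0` imposes on `M`. -/
theorem sum_finrank_iSup_range_le {k : Type*} [Field k] {P Q : Type*} [Fintype P] [Fintype Q]
    {H : Q → P → Type*} [∀ q p, AddCommGroup (H q p)] [∀ q p, Module k (H q p)]
    {Z : Q → Type*} [∀ q, AddCommGroup (Z q)] [∀ q, Module k (Z q)]
    [∀ q, FiniteDimensional k (Z q)] (T : ∀ q p, H q p →ₗ[k] Z q)
    (Φ : (∀ q p, H q p) →ₗ[k] ∀ q, Z q) (hΦ : ∀ y q, Φ y q = ∑ p, T q p (y q p)) :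
    ∑ q, Module.finrank k ↥(⨆ p, LinearMap.range (T q p)) ≤
      Module.finrank k (LinearMap.range Φ) := by
  classical
  let S : ∀ q, Submodule k (Z q) := fun q => ⨆ p, LinearMap.range (T q p)
  have hS : ∀ q (z : S q), ∃ h : ∀ p, H q p, ∑ p, T q p (h p) = z := by
    intro q z
    let Ψ : (∀ p, H q p) →ₗ[k] Z q := ∑ p, T q p ∘ₗ LinearMap.proj p
    have h1 : S q ≤ LinearMap.range Ψ := by
      refine iSup_le fun p => ?_
      rintro _ ⟨h, rfl⟩
      refine ⟨Pi.single p h, ?_⟩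
      simp only [Ψ, LinearMap.sum_apply, LinearMap.comp_apply, LinearMap.proj_apply]
      rw [Finset.sum_eq_single p]
      · rw [Pi.single_eq_same]
      · intro p' _ hp'
        rw [Pi.single_eq_of_ne hp', map_zero]
      · simp
    obtain ⟨h, hh⟩ := h1 z.2
    exact ⟨h, by simpa [Ψ] using hh⟩
  let inc : (∀ q, S q) →ₗ[k] ∀ q, Z q := LinearMap.pi fun q => (S q).subtype ∘ₗ LinearMap.proj q
  have hinc : Function.Injective inc := fun z w h =>
    funext fun q => Subtype.ext (congrFun h q)
  have hle : LinearMap.range inc ≤ LinearMap.range Φ := by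
    rintro _ ⟨z, rfl⟩
    choose y hy using fun q => hS q (z q)
    exact ⟨y, funext fun q => (hΦ y q).trans (hy q)⟩
  rw [← Module.finrank_pi_fintype, ← LinearMap.finrank_range_of_inj hinc]
  exact Submodule.finrank_mono hle

/-! ### Equations of subspaces in charts of Grassmannians -/

section Charts

variable {k : Type u} [Field k] {I P : Type} {A : I → Type u} [∀ i, AddCommGroup (A i)]
  [∀ i, Module k (A i)] {κ : I → Type} [∀ i, DecidableEq (κ i)]

/-- The parameters of the charts of the Grassmannians of the spaces `A i` that are given by the
sets `D i`. -/
abbrev ChartParam (D : ∀ i, Finset (κ i)) : Type :=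
  Σ i, {c // c ∉ D i} × {j // j ∈ D i}

variable [∀ i, Fintype (κ i)]

/-- The equations saying that each `x p` lies in the subspace of `A (τ p)` with parameter `u`. -/
noncomputable def chartEquations (b : ∀ i, Module.Basis (κ i) k (A i)) (τ : P → I)
    (D : ∀ i, Finset (κ i)) (u : ChartParam D → k) :
    (∀ p, A (τ p)) →ₗ[k] ((Σ p, {j // j ∈ D (τ p)}) → k) :=
  LinearMap.pi fun r => ((b (τ r.1)).coord r.2 -
    ∑ c : {c // c ∉ D (τ r.1)}, u ⟨τ r.1, c, r.2⟩ • (b (τ r.1)).coord c) ∘ₗ LinearMap.proj r.1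

theorem chartEquations_apply (b : ∀ i, Module.Basis (κ i) k (A i)) (τ : P → I)
    (D : ∀ i, Finset (κ i)) (u : ChartParam D → k) (x : ∀ p, A (τ p))
    (r : Σ p, {j // j ∈ D (τ p)}) :
    chartEquations b τ D u x r = (b (τ r.1)).repr (x r.1) r.2 -
      ∑ c : {c // c ∉ D (τ r.1)}, u ⟨τ r.1, c, r.2⟩ * (b (τ r.1)).repr (x r.1) c := by
  simp [chartEquations]

theorem exists_polynomial_chartEquations (b : ∀ i, Module.Basis (κ i) k (A i)) (τ : P → I)
    (D : ∀ i, Finset (κ i)) (x : ∀ p, A (τ p)) (r : Σ p, {j // j ∈ D (τ p)}) :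
    ∃ p : MvPolynomial (ChartParam D) k, ∀ u,
      MvPolynomial.aeval u p = chartEquations b τ D u x r := by
  refine ⟨MvPolynomial.C ((b (τ r.1)).repr (x r.1) r.2) -
    ∑ c : {c // c ∉ D (τ r.1)}, MvPolynomial.X ⟨τ r.1, c, r.2⟩ *
      MvPolynomial.C ((b (τ r.1)).repr (x r.1) c), fun u => ?_⟩
  rw [chartEquations_apply]
  simp

/-- The coordinates in `D` may be prescribed with all others zero, so the equations are independent
for every `u`. -/
theorem chartEquations_surjective (b : ∀ i, Module.Basis (κ i) k (A i)) (τ : P → I)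
    (D : ∀ i, Finset (κ i)) (u : ChartParam D → k) :
    Function.Surjective (chartEquations b τ D u) := by
  intro t
  refine ⟨fun p => ∑ j : {j // j ∈ D (τ p)}, t ⟨p, j⟩ • b (τ p) j, funext fun r => ?_⟩
  have h1 : ∀ c, (b (τ r.1)).repr (∑ j : {j // j ∈ D (τ r.1)}, t ⟨r.1, j⟩ • b (τ r.1) j) c =
      ∑ j : {j // j ∈ D (τ r.1)}, if (j : κ (τ r.1)) = c then t ⟨r.1, j⟩ else 0 := by
    intro c
    simp [Finsupp.single_apply]
  rw [chartEquations_apply]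
  simp only [h1]
  rw [Finset.sum_eq_single r.2 (fun j _ hj => if_neg fun h => hj (Subtype.ext h)) (by simp),
    if_pos rfl, Finset.sum_eq_zero fun c _ => ?_, sub_zero]
  exact mul_eq_zero_of_right _ (Finset.sum_eq_zero fun j _ => if_neg fun h =>
    c.2 (by rw [← h]; exact j.2))

theorem card_chartParam [Fintype I] {n d : I → ℕ} {D : ∀ i, Finset (κ i)}
    (hn : ∀ i, Fintype.card (κ i) = n i) (hd : ∀ i, (D i).card + d i = Fintype.card (κ i)) :
    Fintype.card (ChartParam D) = ∑ i, d i * (n i - d i) := by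
  rw [Fintype.card_sigma]
  refine Finset.sum_congr rfl fun i _ => ?_
  have h2 := hd i
  have h3 := Fintype.card_subtype_compl (· ∈ D i)
  rw [Fintype.card_coe] at h3
  rw [Fintype.card_prod, Fintype.card_coe, h3]
  have h4 := hn i
  congr 1 <;> omega

omit [∀ i, DecidableEq (κ i)] in
theorem card_sigma_chart_add [Fintype P] {n d : I → ℕ} {D : ∀ i, Finset (κ i)} (τ : P → I)
    (hn : ∀ i, Fintype.card (κ i) = n i) (hd : ∀ i, (D i).card + d i = Fintype.card (κ i)) :
    Fintype.card (Σ p, {j // j ∈ D (τ p)}) + ∑ p, d (τ p) = ∑ p, n (τ p) := by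
  rw [Fintype.card_sigma, ← Finset.sum_add_distrib]
  refine Finset.sum_congr rfl fun p _ => ?_
  rw [Fintype.card_coe, hd, hn]

end Charts

/-! ### Evaluation of matrices, its transpose, and the two dimension counts -/

section Kronecker

variable {k : Type u} [Field k] {I J P Q : Type} [Fintype P]
  {A : I → Type u} [∀ i, AddCommGroup (A i)] [∀ i, Module k (A i)]
  {B : J → Type u} [∀ j, AddCommGroup (B j)] [∀ j, Module k (B j)]
  {H : I → J → Type u} [∀ i j, AddCommGroup (H i j)] [∀ i j, Module k (H i j)]
  (e : ∀ i j, A i →ₗ[k] H i j →ₗ[k] B j) (τ : P → I) (υ : Q → J)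

/-- The evaluation `(x, M) ↦ M x` of a matrix `M` of homomorphisms. -/
noncomputable def matrixEval : (∀ p, A (τ p)) →ₗ[k] (∀ q p, H (τ p) (υ q)) →ₗ[k] ∀ q, B (υ q) :=
  LinearMap.mk₂ k (fun x M q => ∑ p, e _ _ (x p) (M q p))
    (fun x x' M => by ext q; simp [Finset.sum_add_distrib])
    (fun c x M => by ext q; simp [Finset.smul_sum])
    (fun x M M' => by ext q; simp [Finset.sum_add_distrib])
    (fun c x M => by ext q; simp [Finset.smul_sum])

theorem matrixEval_apply (x : ∀ p, A (τ p)) (M : ∀ q p, H (τ p) (υ q)) (q : Q) :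
    matrixEval e τ υ x M q = ∑ p, e _ _ (x p) (M q p) := rfl

/-- The transpose evaluation `(y, M) ↦ y ∘ M` of a matrix `M` of homomorphisms. -/
noncomputable def matrixCoeval [Fintype Q] : (∀ q, Module.Dual k (B (υ q))) →ₗ[k]
    (∀ p q, H (τ p) (υ q)) →ₗ[k] ∀ p, Module.Dual k (A (τ p)) :=
  LinearMap.mk₂ k (fun y M p => ∑ q, ((e (τ p) (υ q)).compr₂ (y q)).flip (M p q))
    (fun y y' M => by ext p a; simp [Finset.sum_add_distrib])
    (fun c y M => by ext p a; simp [Finset.mul_sum])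
    (fun y M M' => by ext p a; simp [Finset.sum_add_distrib])
    (fun c y M => by ext p a; simp [Finset.mul_sum])

omit [Fintype P] in
theorem matrixCoeval_apply [Fintype Q] (y : ∀ q, Module.Dual k (B (υ q))) (M : ∀ p q, H (τ p) (υ q))
    (p : P) :
    matrixCoeval e τ υ y M p = ∑ q, ((e (τ p) (υ q)).compr₂ (y q)).flip (M p q) := rfl

variable [∀ i j, FiniteDimensional k (H i j)]

/-- The equations saying that the functionals `y q` vanish on the images of the subspaces of
the `A i` with parameter `u`. -/
noncomputable def subspaceEquations {κ : I → Type} [∀ i, Fintype (κ i)] [∀ i, DecidableEq (κ i)]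
    (b : ∀ i, Module.Basis (κ i) k (A i)) (D : ∀ i, Finset (κ i)) (u : ChartParam D → k) :
    (∀ q, Module.Dual k (B (υ q))) →ₗ[k]
      ((Σ i, {c // c ∉ D i} × Σ q, Fin (Module.finrank k (H i (υ q)))) → k) :=
  LinearMap.pi fun r => Module.Dual.eval k (B (υ r.2.2.1)) (e r.1 (υ r.2.2.1)
    (b r.1 r.2.1 + ∑ j : {j // j ∈ D r.1}, u ⟨r.1, r.2.1, j⟩ • b r.1 j)
    (Module.finBasis k _ r.2.2.2)) ∘ₗ LinearMap.proj r.2.2.1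

omit [Fintype P] in
theorem subspaceEquations_apply {κ : I → Type} [∀ i, Fintype (κ i)] [∀ i, DecidableEq (κ i)]
    (b : ∀ i, Module.Basis (κ i) k (A i)) (D : ∀ i, Finset (κ i)) (u : ChartParam D → k)
    (y : ∀ q, Module.Dual k (B (υ q)))
    (r : Σ i, {c // c ∉ D i} × Σ q, Fin (Module.finrank k (H i (υ q)))) :
    subspaceEquations e υ b D u y r = y r.2.2.1 (e r.1 (υ r.2.2.1)
      (b r.1 r.2.1 + ∑ j : {j // j ∈ D r.1}, u ⟨r.1, r.2.1, j⟩ • b r.1 j)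
      (Module.finBasis k _ r.2.2.2)) := rfl

omit [Fintype P] in
theorem exists_polynomial_subspaceEquations {κ : I → Type} [∀ i, Fintype (κ i)]
    [∀ i, DecidableEq (κ i)] (b : ∀ i, Module.Basis (κ i) k (A i)) (D : ∀ i, Finset (κ i))
    (y : ∀ q, Module.Dual k (B (υ q)))
    (r : Σ i, {c // c ∉ D i} × Σ q, Fin (Module.finrank k (H i (υ q)))) :
    ∃ p : MvPolynomial (ChartParam D) k, ∀ u,
      MvPolynomial.aeval u p = subspaceEquations e υ b D u y r := by
  let f : A r.1 → k := fun a => y r.2.2.1 (e r.1 (υ r.2.2.1) a (Module.finBasis k _ r.2.2.2))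
  refine ⟨MvPolynomial.C (f (b r.1 r.2.1)) + ∑ j : {j // j ∈ D r.1},
    MvPolynomial.X ⟨r.1, r.2.1, j⟩ * MvPolynomial.C (f (b r.1 j)), fun u => ?_⟩
  rw [subspaceEquations_apply]
  simp [f]

variable [Fintype I] [Fintype Q] [∀ i, FiniteDimensional k (A i)]
  [∀ j, FiniteDimensional k (B j)]

/-- By hypothesis the parameters for `K`, together with those for `x` in the sum of the `K (τ p)`,
number at most the conditions on `M`. The bad `M` therefore form a finite union of thin sets, one
for each choice of charts. -/
theorem exists_matrixEval_injective [Infinite k]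
    (hyp : ∀ x : ∀ p, A (τ p), x ≠ 0 → ∃ K : ∀ i, Submodule k (A i), (∀ p, x p ∈ K (τ p)) ∧
      ∑ i, Module.finrank k (K i) * (Module.finrank k (A i) - Module.finrank k (K i)) +
        ∑ p, Module.finrank k (K (τ p)) ≤
      ∑ q, Module.finrank k ↥(⨆ p, LinearMap.range (e (τ p) (υ q) (x p)))) :
    ∃ M : ∀ q p, H (τ p) (υ q), ∀ x, matrixEval e τ υ x M = 0 → x = 0 := by
  classical
  let b := fun i => Module.finBasis k (A i)
  -- `w₁` counts the chart equations, and `w₂` is chosen to complete the count; that `x` imposes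
  -- `w₂` conditions on `M` is then what `hyp` provides.
  have hthin := fun D => isThin_incidence (chartEquations b τ D)
    (exists_polynomial_chartEquations b τ D) (matrixEval e τ υ)
    (w₁ := Fintype.card (Σ p, {j // j ∈ D (τ p)}))
    (w₂ := Fintype.card (ChartParam D) + Module.finrank k (∀ p, A (τ p)) -
      Fintype.card (Σ p, {j // j ∈ D (τ p)})) (by omega)
  obtain ⟨M, hM⟩ := (IsThin.iUnion hthin).exists_notMem
  refine ⟨M, fun x hx => ?_⟩
  by_contra hx0
  obtain ⟨K, hxK, hK⟩ := hyp x hx0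
  choose D u hD hu _ using fun i => exists_chart (b i) (K i)
  refine hM (Set.mem_iUnion.2 ⟨D, fun s => u s.1 s.2.1 s.2.2, x, hx0, ?_, ?_, hx, ?_⟩)
  · ext r
    rw [chartEquations_apply, hu _ _ (hxK r.1) r.2]
    exact sub_self _
  · rw [LinearMap.range_eq_top.2 (chartEquations_surjective b τ D _), finrank_top,
      Module.finrank_pi]
  · refine le_trans ?_ (sum_finrank_iSup_range_le (fun q p => e (τ p) (υ q) (x p)) _
      fun M q => matrixEval_apply e τ υ x M q)
    refine le_trans ?_ hK
    have hn : ∀ i, Fintype.card (Fin (Module.finrank k (A i))) = Module.finrank k (A i) :=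
      fun i => Fintype.card_fin _
    have h1 := card_chartParam hn hD
    have h2 := card_sigma_chart_add τ hn hD
    have h3 := Module.finrank_pi_fintype k (M := fun p => A (τ p))
    omega

omit [Fintype P] [Fintype I] [∀ i, FiniteDimensional k (A i)] in
-- A solution `y` has each `y q` in the annihilator of `W q`, so the kernel has dimension at most
-- the sum of the codimensions of the `W q`.
theorem sum_finrank_le_finrank_range_subspaceEquations {κ : I → Type} [∀ i, Fintype (κ i)]
    [∀ i, DecidableEq (κ i)] (b : ∀ i, Module.Basis (κ i) k (A i)) (D : ∀ i, Finset (κ i))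
    (u : ChartParam D → k) (K : ∀ i, Submodule k (A i))
    (hK : ∀ i, K i = Submodule.span k (Set.range fun c : {c // c ∉ D i} =>
      b i c + ∑ j : {j // j ∈ D i}, u ⟨i, c, j⟩ • b i j)) :
    ∑ q, Module.finrank k ↥(⨆ i, Submodule.map₂ (e i (υ q)) (K i) ⊤) ≤
      Module.finrank k (LinearMap.range (subspaceEquations e υ b D u)) := by
  let W : ∀ q, Submodule k (B (υ q)) := fun q => ⨆ i, Submodule.map₂ (e i (υ q)) (K i) ⊤
  have hW : ∀ y ∈ LinearMap.ker (subspaceEquations e υ b D u), ∀ q,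
      y q ∈ (W q).dualAnnihilator := by
    intro y hy q
    rw [Submodule.mem_dualAnnihilator]
    suffices h : W q ≤ LinearMap.ker (y q) from fun w hw => h hw
    refine iSup_le fun i => Submodule.map₂_le.2 fun a ha h _ => ?_
    suffices h1 : K i ≤ LinearMap.ker ((e i (υ q)).compr₂ (y q)) from
      LinearMap.congr_fun (LinearMap.mem_ker.1 (h1 ha)) h
    rw [hK, Submodule.span_le]
    rintro _ ⟨c, rfl⟩
    refine (Module.finBasis k (H i (υ q))).ext fun l => ?_
    have h2 := congrFun (LinearMap.mem_ker.1 hy) ⟨i, c, q, l⟩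
    rw [subspaceEquations_apply] at h2
    exact h2
  let Φ : LinearMap.ker (subspaceEquations e υ b D u) →ₗ[k] ∀ q, (W q).dualAnnihilator :=
    { toFun := fun y q => ⟨y.1 q, hW _ y.2 q⟩
      map_add' := fun _ _ => rfl
      map_smul' := fun _ _ => rfl }
  have hΦ : Function.Injective Φ := fun y z h =>
    Subtype.ext (funext fun q => congrArg Subtype.val (congrFun h q))
  have h1 := LinearMap.finrank_le_finrank_of_injective hΦ
  have h2 := (subspaceEquations e υ b D u).finrank_range_add_finrank_ker
  have : ∀ q, Module.Free k (W q).dualAnnihilator := fun q =>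
    @Module.Free.of_divisionRing k (W q).dualAnnihilator _ _ _
  have : ∀ q, Module.Finite k (W q).dualAnnihilator := fun q => inferInstance
  have h3 : ∑ q, Module.finrank k (W q) + Module.finrank k (∀ q, (W q).dualAnnihilator) =
      Module.finrank k (∀ q, Module.Dual k (B (υ q))) := by
    rw [Module.finrank_pi_fintype, Module.finrank_pi_fintype, ← Finset.sum_add_distrib]
    refine Finset.sum_congr rfl fun q _ => ?_
    rw [Subspace.finrank_add_finrank_dualAnnihilator_eq, Subspace.dual_finrank_eq]
  change ∑ q, Module.finrank k (W q) ≤ _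
  omega

/-- For fixed `K` the functionals `y` fill at most `∑ (dim B - dim W)` dimensions, and `y ∘ M = 0`
imposes at least `∑ (dim A - dim K)` conditions on `M`; the last hypothesis compares these numbers,
including the parameters for `K`. -/
theorem exists_matrixCoeval_injective [Infinite k]
    (hyp : ∀ y : ∀ q, Module.Dual k (B (υ q)), y ≠ 0 → ∃ K : ∀ i, Submodule k (A i),
      (∀ q i, ∀ a ∈ K i, ∀ h, y q (e i (υ q) a h) = 0) ∧
      (∀ p, Module.finrank k (A (τ p)) ≤ Module.finrank k (K (τ p)) +
        Module.finrank k ↥(⨆ q, LinearMap.range (((e (τ p) (υ q)).compr₂ (y q)).flip))) ∧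
      ∑ i, Module.finrank k (K i) * (Module.finrank k (A i) - Module.finrank k (K i)) +
        ∑ q, Module.finrank k (B (υ q)) + ∑ p, Module.finrank k (K (τ p)) ≤
      ∑ p, Module.finrank k (A (τ p)) +
        ∑ q, Module.finrank k ↥(⨆ i, Submodule.map₂ (e i (υ q)) (K i) ⊤)) :
    ∃ M : ∀ p q, H (τ p) (υ q), ∀ y, matrixCoeval e τ υ y M = 0 → y = 0 := by
  classical
  let b := fun i => Module.finBasis k (A i)
  have hthin := fun D => isThin_incidence (subspaceEquations e υ b D)
    (exists_polynomial_subspaceEquations e υ b D) (matrixCoeval e τ υ)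
    (w₁ := Fintype.card (ChartParam D) + Module.finrank k (∀ q, Module.Dual k (B (υ q))) -
      Fintype.card (Σ p, {j // j ∈ D (τ p)}))
    (w₂ := Fintype.card (Σ p, {j // j ∈ D (τ p)})) (by omega)
  obtain ⟨M, hM⟩ := (IsThin.iUnion hthin).exists_notMem
  refine ⟨M, fun y hy => ?_⟩
  by_contra hy0
  obtain ⟨K, hyK, hr, hK⟩ := hyp y hy0
  choose D u hD _ hu using fun i => exists_chart (b i) (K i)
  have hn : ∀ i, Fintype.card (Fin (Module.finrank k (A i))) = Module.finrank k (A i) :=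
    fun i => Fintype.card_fin _
  have h2 := card_sigma_chart_add τ hn hD
  refine hM (Set.mem_iUnion.2 ⟨D, fun s => u s.1 s.2.1 s.2.2, y, hy0, ?_, ?_, hy, ?_⟩)
  · ext r
    rw [subspaceEquations_apply]
    refine hyK _ _ _ ?_ _
    rw [hu r.1]
    exact Submodule.subset_span ⟨r.2.1, rfl⟩
  · refine le_trans ?_ (sum_finrank_le_finrank_range_subspaceEquations e υ b D _ K hu)
    have h1 := card_chartParam hn hD
    have h3 : Module.finrank k (∀ q, Module.Dual k (B (υ q))) =
        ∑ q, Module.finrank k (B (υ q)) := by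
      rw [Module.finrank_pi_fintype]
      exact Finset.sum_congr rfl fun q _ => Subspace.dual_finrank_eq
    omega
  · refine le_trans ?_ (sum_finrank_iSup_range_le
      (fun p q => ((e (τ p) (υ q)).compr₂ (y q)).flip) _
      fun M p => matrixCoeval_apply e τ υ y M p)
    have h3 : ∑ p, Module.finrank k (A (τ p)) ≤ ∑ p, Module.finrank k (K (τ p)) +
        ∑ p, Module.finrank k
          ↥(⨆ q, LinearMap.range (((e (τ p) (υ q)).compr₂ (y q)).flip)) := by
      rw [← Finset.sum_add_distrib]
      exact Finset.sum_le_sum fun p _ => hr p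
    omega

end Kronecker

/-! ## The numerical estimate -/

/-- Everything is compared with the largest slope `ρ = κ i / e i`. Writing `min` lets one inequality
serve both the injective and the surjective case. -/
theorem sum_mul_sub_add_min_le {I J P Q : Type*} [Fintype I] [Fintype P] [Fintype Q]
    (τ : P → I) (υ : Q → J) (e κ : I → ℕ) (f : J → ℕ) (w : Q → ℕ) (α β : ℕ)
    (hκ : ∀ i, κ i < e i) (hκ0 : ∃ i, κ i ≠ 0) (hβ0 : β ≠ 0)
    (hw : ∀ i q, κ i ≠ 0 → κ i * f (υ q) < w q * e i)
    (hα : ∀ i, e i ≤ α) (hβ : ∀ j, f j ≤ β)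
    (hmax : α * β * ∑ i, e i ^ 2 ≤ 4 * max (∑ p, e (τ p)) (∑ q, f (υ q))) :
    ∑ i, κ i * (e i - κ i) + min (∑ p, e (τ p)) (∑ q, f (υ q)) + ∑ p, κ (τ p) ≤
      ∑ p, e (τ p) + ∑ q, w q := by
  obtain ⟨i₁, hi₁⟩ := hκ0
  obtain ⟨i₀, -, hi₀⟩ := Finset.exists_max_image Finset.univ (fun i => (κ i / e i : ℝ))
    ⟨i₁, Finset.mem_univ _⟩
  have he : ∀ i, (0 : ℝ) < e i := fun i => Nat.cast_pos.2 ((Nat.zero_le _).trans_lt (hκ i))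
  set ρ : ℝ := κ i₀ / e i₀ with hρ
  have hρ0 : 0 < ρ := lt_of_lt_of_le (div_pos (Nat.cast_pos.2 (Nat.pos_of_ne_zero hi₁)) (he i₁))
    (hi₀ i₁ (Finset.mem_univ _))
  have hκi₀ : κ i₀ ≠ 0 := fun h => by simp [hρ, h] at hρ0
  have hκe : ∀ i, (κ i : ℝ) ≤ ρ * e i := fun i =>
    (div_le_iff₀ (he i)).1 (hi₀ i (Finset.mem_univ _))
  have hα0 : (0 : ℝ) < α := (he i₀).trans_le (Nat.cast_le.2 (hα i₀))
  have hα' : (e i₀ : ℝ) ≤ α := Nat.cast_le.2 (hα i₀)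
  have hρ1 : 1 / α ≤ 1 - ρ := by
    have h1 : (κ i₀ + 1 : ℝ) ≤ e i₀ := by exact_mod_cast hκ i₀
    have h2 : 1 / (α : ℝ) ≤ 1 / e i₀ := one_div_le_one_div_of_le (he i₀) hα'
    have h3 : 1 - ρ = (e i₀ - κ i₀) / e i₀ := by rw [hρ, sub_div, div_self (he i₀).ne']
    rw [h3]
    exact h2.trans (div_le_div_of_nonneg_right (by linarith) (he i₀).le)
  -- A strict inequality of integers leaves a gap of at least `1`; division by `e i₀ ≤ α` turns it
  -- into a gain of `1 / α` for each `q`.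
  have hwq : ∀ q, ρ * f (υ q) + 1 / α ≤ w q := by
    intro q
    have h1 : (κ i₀ * f (υ q) + 1 : ℝ) ≤ w q * e i₀ := by exact_mod_cast hw i₀ q hκi₀
    have h2 : 1 / (α : ℝ) ≤ 1 / e i₀ := one_div_le_one_div_of_le (he i₀) hα'
    have h3 : ρ * f (υ q) + 1 / e i₀ ≤ w q := by
      rw [hρ, div_mul_eq_mul_div, ← add_div, div_le_iff₀ (he i₀)]
      exact h1
    linarith
  set U₁ : ℝ := ∑ p, (e (τ p) : ℝ) with hU₁
  set U₂ : ℝ := ∑ q, (f (υ q) : ℝ) with hU₂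
  have hS₁ : ∑ p, (κ (τ p) : ℝ) ≤ ρ * U₁ := by
    rw [hU₁, Finset.mul_sum]
    exact Finset.sum_le_sum fun p _ => hκe _
  have hS₂ : ρ * U₂ + Fintype.card Q / α ≤ ∑ q, (w q : ℝ) := by
    refine le_trans (le_of_eq ?_) (Finset.sum_le_sum fun q _ => hwq q)
    rw [Finset.sum_add_distrib, ← Finset.mul_sum, Finset.sum_const, Finset.card_univ,
      nsmul_eq_mul, mul_one_div]
  have hU₂Q : U₂ ≤ β * Fintype.card Q := by
    rw [hU₂]
    refine (Finset.sum_le_card_nsmul Finset.univ _ (β : ℝ) fun q _ =>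
      Nat.cast_le.2 (hβ _)).trans (le_of_eq ?_)
    rw [nsmul_eq_mul, mul_comm, Finset.card_univ]
  -- The bound `4κ(e - κ) ≤ e²` is the origin of the factor `1/4` in the theorem.
  have hG : ∑ i, (κ i * (e i - κ i) : ℝ) ≤ (∑ i, (e i : ℝ) ^ 2) / 4 := by
    rw [Finset.sum_div]
    exact Finset.sum_le_sum fun i _ => by nlinarith [sq_nonneg ((e i : ℝ) - 2 * κ i)]
  have hU₁0 : 0 ≤ U₁ := Finset.sum_nonneg fun _ _ => Nat.cast_nonneg _
  have hU₂0 : 0 ≤ U₂ := Finset.sum_nonneg fun _ _ => Nat.cast_nonneg _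
  have hmax' : (α * β * ∑ i, (e i : ℝ) ^ 2) ≤ 4 * max U₁ U₂ := by
    have : ((α * β * ∑ i, e i ^ 2 : ℕ) : ℝ) ≤
        (4 * max (∑ p, e (τ p)) (∑ q, f (υ q)) : ℕ) := Nat.cast_le.2 hmax
    push_cast at this
    exact this
  suffices h : ∑ i, (κ i * (e i - κ i) : ℝ) + min U₁ U₂ + ∑ p, (κ (τ p) : ℝ) ≤
      U₁ + ∑ q, (w q : ℝ) by
    have h1 : ∑ i, (κ i * (e i - κ i) : ℝ) = (∑ i, κ i * (e i - κ i) : ℕ) := by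
      push_cast
      exact Finset.sum_congr rfl fun i _ => by rw [Nat.cast_sub (hκ i).le]
    rw [h1, hU₁, hU₂] at h
    exact_mod_cast h
  have hβ1 : (1 : ℝ) ≤ β := by exact_mod_cast Nat.one_le_iff_ne_zero.2 hβ0
  have hβ2 : (0 : ℝ) < β := by linarith
  have hQα : U₂ / (α * β) ≤ Fintype.card Q / α := by
    rw [div_le_div_iff₀ (by positivity) hα0]
    nlinarith
  have hGU : ∑ i, (κ i * (e i - κ i) : ℝ) ≤ max U₁ U₂ / (α * β) := by
    refine hG.trans ?_
    rw [div_le_div_iff₀ (by norm_num) (by positivity)]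
    linarith
  -- If `U₁ ≤ U₂`, the gains `|Q| / α ≥ U₂ / (αβ)` absorb the Grassmannian term. Otherwise they
  -- absorb its part `U₂ / (αβ)`, and the rest, `(U₁ - U₂) / (αβ)`, is at most `(1 - ρ)(U₁ - U₂)`
  -- because `1 - ρ ≥ 1 / α`.
  rcases le_total U₁ U₂ with h | h
  · rw [max_eq_right h] at hGU
    rw [min_eq_left h]
    nlinarith
  · rw [max_eq_left h] at hGU
    rw [min_eq_right h]
    have h1 : (U₁ - U₂) / (α * β) ≤ (1 - ρ) * (U₁ - U₂) := by
      have h2 : (U₁ - U₂) / (α * β) ≤ (U₁ - U₂) / α :=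
        div_le_div_of_nonneg_left (by linarith) hα0 (le_mul_of_one_le_right hα0.le hβ1)
      have h3 : (U₁ - U₂) / α = 1 / α * (U₁ - U₂) := by ring
      have h4 := mul_le_mul_of_nonneg_right hρ1 (sub_nonneg.2 h)
      linarith
    rw [sub_div] at h1
    nlinarith

/-! ## Maximal rank of general Kronecker maps -/

/-- Only the image of `H` in the finite-dimensional space of maps `A → B` matters, and a linear
section over it gives `H'`. The counts can thus be made in a finite-dimensional space of matrices.
-/
theorem exists_finiteDimensional_evaluation {k A B H : Type*} [Field k] [AddCommGroup A]
    [Module k A] [FiniteDimensional k A] [AddCommGroup B] [Module k B] [FiniteDimensional k B]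
    [AddCommGroup H] [Module k H] (e : A →ₗ[k] H →ₗ[k] B) :
    ∃ H' : Submodule k H, FiniteDimensional k H' ∧ ∀ h, ∃ h' ∈ H', ∀ a, e a h' = e a h := by
  obtain ⟨σ, hσ⟩ := e.flip.rangeRestrict.exists_rightInverse_of_surjective
    (LinearMap.range_rangeRestrict _)
  refine ⟨LinearMap.range σ, inferInstance, fun h =>
    ⟨σ (e.flip.rangeRestrict h), ⟨_, rfl⟩, fun a => ?_⟩⟩
  have h1 := congrArg Subtype.val (LinearMap.congr_fun hσ (e.flip.rangeRestrict h))
  exact LinearMap.congr_fun h1 a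

/-- Termwise `d(n - d) + sd ≤ sn`, as `d ≤ s`. This replaces the stability estimate when some `K i`
is the whole space. -/
theorem sum_mul_sub_add_sum_le {I : Type*} [Fintype I] {s : I → ℕ} (d n : I → ℕ)
    (hd : ∀ i, d i ≤ n i) (hs : ∀ i, d i ≤ s i) :
    ∑ i, d i * (n i - d i) + ∑ p : Σ i, Fin (s i), d p.1 ≤ ∑ p : Σ i, Fin (s i), n p.1 := by
  rw [Fintype.sum_sigma, Fintype.sum_sigma, ← Finset.sum_add_distrib]
  refine Finset.sum_le_sum fun i _ => ?_
  simp only [Finset.sum_const, Finset.card_univ, Fintype.card_fin, smul_eq_mul]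
  calc d i * (n i - d i) + s i * d i ≤ s i * (n i - d i) + s i * d i := by
        gcongr
        exact hs i
    _ = s i * n i := by rw [← mul_add, Nat.sub_add_cancel (hd i)]

section Kronecker

variable {k : Type u} [Field k] {I J P Q : Type} [Fintype P] [Fintype I] [Fintype Q]
  {A : I → Type u} [∀ i, AddCommGroup (A i)] [∀ i, Module k (A i)]
  {B : J → Type u} [∀ j, AddCommGroup (B j)] [∀ j, Module k (B j)]
  {H : I → J → Type u} [∀ i j, AddCommGroup (H i j)] [∀ i j, Module k (H i j)]
  [∀ i, FiniteDimensional k (A i)] [∀ j, FiniteDimensional k (B j)]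
  (e : ∀ i j, A i →ₗ[k] H i j →ₗ[k] B j)

theorem sum_mul_sub_add_min_le_of_stable (τ : P → I) (υ : Q → J)
    (hst : ∀ i j (K : Submodule k (A i)), K ≠ ⊥ → K ≠ ⊤ →
      Module.finrank k K * Module.finrank k (B j) <
        Module.finrank k (Submodule.map₂ (e i j) K ⊤) * Module.finrank k (A i))
    (α β : ℕ) (hα : ∀ i, Module.finrank k (A i) ≤ α) (hβ : ∀ j, Module.finrank k (B j) ≤ β)
    (hβ0 : β ≠ 0)
    (hmax : α * β * ∑ i, Module.finrank k (A i) ^ 2 ≤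
      4 * max (∑ p, Module.finrank k (A (τ p))) (∑ q, Module.finrank k (B (υ q))))
    (K : ∀ i, Submodule k (A i)) (hK : ∀ i, K i ≠ ⊤) (hK0 : ∃ i, K i ≠ ⊥) :
    ∑ i, Module.finrank k (K i) * (Module.finrank k (A i) - Module.finrank k (K i)) +
        min (∑ p, Module.finrank k (A (τ p))) (∑ q, Module.finrank k (B (υ q))) +
        ∑ p, Module.finrank k (K (τ p)) ≤
      ∑ p, Module.finrank k (A (τ p)) +
        ∑ q, Module.finrank k ↥(⨆ i, Submodule.map₂ (e i (υ q)) (K i) ⊤) := by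
  refine sum_mul_sub_add_min_le τ υ _ (fun i => Module.finrank k (K i)) _ _ α β
    (fun i => Submodule.finrank_lt (hK i)) ?_ hβ0 (fun i q hi => ?_) hα hβ hmax
  · obtain ⟨i, hi⟩ := hK0
    exact ⟨i, fun h => hi (Submodule.finrank_eq_zero.1 h)⟩
  · refine (hst i (υ q) (K i) (fun h => hi (Submodule.finrank_eq_zero.2 h)) (hK i)).trans_le ?_
    exact Nat.mul_le_mul_right _ (Submodule.finrank_mono
      (le_iSup (fun i => Submodule.map₂ (e i (υ q)) (K i) ⊤) i))

theorem exists_matrixEval_injective_of_le [Infinite k] {s : I → ℕ} (υ : Q → J)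
    (hsurj : ∀ i j, Submodule.map₂ (e i j) ⊤ ⊤ = ⊤)
    (hle : ∑ p : Σ i, Fin (s i), Module.finrank k (A p.1) ≤ ∑ q, Module.finrank k (B (υ q)))
    (hnum : ∀ K : ∀ i, Submodule k (A i), (∀ i, K i ≠ ⊤) → (∃ i, K i ≠ ⊥) →
      ∑ i, Module.finrank k (K i) * (Module.finrank k (A i) - Module.finrank k (K i)) +
        ∑ p : Σ i, Fin (s i), Module.finrank k (K p.1) ≤
      ∑ q, Module.finrank k ↥(⨆ i, Submodule.map₂ (e i (υ q)) (K i) ⊤)) :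
    ∃ M : ∀ (q : Q) (p : Σ i, Fin (s i)), H p.1 (υ q),
      ∀ x, matrixEval e Sigma.fst υ x M = 0 → x = 0 := by
  choose H' hH' hev using fun i j => exists_finiteDimensional_evaluation (e i j)
  let e' : ∀ i j, A i →ₗ[k] H' i j →ₗ[k] B j := fun i j => (e i j).compl₂ (H' i j).subtype
  obtain ⟨M, hM⟩ := exists_matrixEval_injective e' (Sigma.fst : (Σ i, Fin (s i)) → I) υ (by
    intro x hx
    let v : ∀ i, Fin (s i) → A i := fun i m => x ⟨i, m⟩
    let K : ∀ i, Submodule k (A i) := fun i => Submodule.span k (Set.range (v i))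
    have hxK : ∀ p, x p ∈ K p.1 := fun p => Submodule.subset_span ⟨p.2, rfl⟩
    have hmap : ∀ q, ⨆ i, Submodule.map₂ (e i (υ q)) (K i) ⊤ ≤
        ⨆ p, LinearMap.range (e' (Sigma.fst p) (υ q) (x p)) := by
      intro q
      refine iSup_le fun i => Submodule.map₂_le.2 fun a ha h _ => ?_
      obtain ⟨h', hh', hhe⟩ := hev i (υ q) h
      rw [← hhe]
      refine Submodule.span_induction (p := fun a _ => e i (υ q) a h' ∈
        ⨆ p, LinearMap.range (e' (Sigma.fst p) (υ q) (x p))) ?_ ?_ ?_ ?_ ha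
      · rintro _ ⟨m, rfl⟩
        exact Submodule.mem_iSup_of_mem ⟨i, m⟩ ⟨⟨h', hh'⟩, rfl⟩
      · simp
      · intro a b _ _ ha hb
        rw [map_add, LinearMap.add_apply]
        exact Submodule.add_mem _ ha hb
      · intro c a _ ha
        rw [map_smul, LinearMap.smul_apply]
        exact Submodule.smul_mem _ _ ha
    have hW : ∑ q, Module.finrank k ↥(⨆ i, Submodule.map₂ (e i (υ q)) (K i) ⊤) ≤
        ∑ q, Module.finrank k ↥(⨆ p, LinearMap.range (e' (Sigma.fst p) (υ q) (x p))) :=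
      Finset.sum_le_sum fun q _ => Submodule.finrank_mono (hmap q)
    refine ⟨K, hxK, le_trans ?_ hW⟩
    -- If some `K i` is everything, surjectivity of evaluation makes each `W q` everything. Each `K
    -- i` is spanned by `s i` vectors, so the left side is at most `U₁ ≤ U₂`.
    by_cases hK : ∃ i, K i = ⊤
    · obtain ⟨i, hi⟩ := hK
      have h1 : ∀ q, Module.finrank k ↥(⨆ i, Submodule.map₂ (e i (υ q)) (K i) ⊤) =
          Module.finrank k (B (υ q)) := by
        intro q
        have : ⨆ i, Submodule.map₂ (e i (υ q)) (K i) ⊤ = ⊤ := by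
          rw [eq_top_iff, ← hsurj i (υ q), ← hi]
          exact le_iSup (fun i => Submodule.map₂ (e i (υ q)) (K i) ⊤) i
        rw [this, finrank_top]
      simp only [h1]
      refine le_trans ?_ hle
      have h2 : ∀ i, Module.finrank k (K i) ≤ s i := fun i =>
        (finrank_range_le_card (R := k) (v i)).trans_eq (Fintype.card_fin _)
      exact sum_mul_sub_add_sum_le (fun i => Module.finrank k (K i))
        (fun i => Module.finrank k (A i)) (fun i => (K i).finrank_le) h2
    · push Not at hK
      refine hnum K hK ?_
      by_contra! h
      refine hx (funext fun p => ?_)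
      have := hxK p
      rw [h p.1] at this
      exact (Submodule.mem_bot k).1 this)
  exact ⟨fun q p => (M q p : H p.1 (υ q)), hM⟩

theorem exists_matrixEval_surjective_of_le [Infinite k] (τ : P → I) (υ : Q → J) [Nonempty I]
    (hsurj : ∀ i j, Submodule.map₂ (e i j) ⊤ ⊤ = ⊤)
    (hle : ∑ q, Module.finrank k (B (υ q)) ≤ ∑ p, Module.finrank k (A (τ p)))
    (hnum : ∀ K : ∀ i, Submodule k (A i), (∀ i, K i ≠ ⊤) → (∃ i, K i ≠ ⊥) →
      ∑ i, Module.finrank k (K i) * (Module.finrank k (A i) - Module.finrank k (K i)) +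
        ∑ q, Module.finrank k (B (υ q)) + ∑ p, Module.finrank k (K (τ p)) ≤
      ∑ p, Module.finrank k (A (τ p)) +
        ∑ q, Module.finrank k ↥(⨆ i, Submodule.map₂ (e i (υ q)) (K i) ⊤)) :
    ∃ M : ∀ q p, H (τ p) (υ q), ∀ z, ∃ x, matrixEval e τ υ x M = z := by
  classical
  choose H' hH' hev using fun i j => exists_finiteDimensional_evaluation (e i j)
  let e' : ∀ i j, A i →ₗ[k] H' i j →ₗ[k] B j := fun i j => (e i j).compl₂ (H' i j).subtype
  have hmap : ∀ i j (K : Submodule k (A i)),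
      Submodule.map₂ (e i j) K ⊤ ≤ Submodule.map₂ (e' i j) K ⊤ := by
    intro i j K
    refine Submodule.map₂_le.2 fun a ha h _ => ?_
    obtain ⟨h', hh', hhe⟩ := hev i j h
    rw [← hhe]
    exact Submodule.apply_mem_map₂ (e' i j) ha (Submodule.mem_top (x := ⟨h', hh'⟩))
  obtain ⟨M, hM⟩ := exists_matrixCoeval_injective e' τ υ (by
    intro y hy
    let K : ∀ i, Submodule k (A i) := fun i =>
      ⨅ q, LinearMap.ker ((e' i (υ q)).compr₂ (y q))
    have hyK : ∀ q i, ∀ a ∈ K i, ∀ h, y q (e' i (υ q) a h) = 0 := fun q i a ha h =>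
      LinearMap.congr_fun (LinearMap.mem_ker.1 ((Submodule.mem_iInf _).1 ha q)) h
    refine ⟨K, hyK, fun p => ?_, ?_⟩
    -- The vectors killed by every functional in `R` lie in `K (τ p)`, so `R` has dimension at least
    -- the codimension of `K (τ p)`.
    · let R : Submodule k (Module.Dual k (A (τ p))) :=
        ⨆ q, LinearMap.range ((e' (τ p) (υ q)).compr₂ (y q)).flip
      have h1 : R.dualCoannihilator ≤ K (τ p) := by
        intro a ha
        refine (Submodule.mem_iInf _).2 fun q => LinearMap.mem_ker.2 (LinearMap.ext fun h => ?_)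
        exact (Submodule.mem_dualCoannihilator a).1 ha _ (Submodule.mem_iSup_of_mem q ⟨h, rfl⟩)
      have h2 := Subspace.finrank_add_finrank_dualCoannihilator_eq R
      have h3 := Submodule.finrank_mono h1
      change _ ≤ _ + Module.finrank k R
      omega
    -- If `K i` were everything, each `y q` would vanish on the image of evaluation, which is all of
    -- `B (υ q)`.
    · have hKtop : ∀ i, K i ≠ ⊤ := by
        intro i hi
        refine hy (funext fun q => ?_)
        have h1 : Submodule.map₂ (e' i (υ q)) ⊤ ⊤ ≤ LinearMap.ker (y q) :=
          Submodule.map₂_le.2 fun a _ h _ => hyK q i a (hi ▸ Submodule.mem_top) h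
        have h2 := (hmap i (υ q) ⊤).trans h1
        rw [hsurj, top_le_iff, LinearMap.ker_eq_top] at h2
        exact h2
      by_cases hK : ∃ i, K i ≠ ⊥
      · refine (hnum K hKtop hK).trans ?_
        have hW : ∀ q, ⨆ i, Submodule.map₂ (e i (υ q)) (K i) ⊤ ≤
            ⨆ i, Submodule.map₂ (e' i (υ q)) (K i) ⊤ :=
          fun q => iSup_mono fun i => hmap i (υ q) (K i)
        exact Nat.add_le_add_left
          (Finset.sum_le_sum fun q _ => Submodule.finrank_mono (hW q)) _
      · push Not at hK
        have h0 : ∀ i, Module.finrank k (K i) = 0 := fun i => by rw [hK i, finrank_bot]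
        simp only [h0, zero_mul, Finset.sum_const_zero]
        omega)
  refine ⟨fun q p => (M p q : H (τ p) (υ q)), ?_⟩
  let f : (∀ p, A (τ p)) →ₗ[k] ∀ q, B (υ q) :=
    (matrixEval e τ υ).flip fun q p => (M p q : H (τ p) (υ q))
  change Function.Surjective f
  rw [← LinearMap.range_eq_top]
  by_contra hne
  -- A proper image is killed by a nonzero functional, whose components form a `y ≠ 0` with `y ∘ M =
  -- 0`.
  obtain ⟨g, hg, hgf⟩ := Submodule.exists_le_ker_of_lt_top _ (lt_top_iff_ne_top.2 hne)
  refine hg (LinearMap.pi_ext' fun q => ?_)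
  refine congrFun (hM (fun q => g ∘ₗ LinearMap.single k (fun q => B (υ q)) q)
    (funext fun p => ?_)) q
  ext a
  have h1 : g (f (Pi.single p a)) = 0 := hgf ⟨_, rfl⟩
  have h2 : f (Pi.single p a) =
      ∑ q, Pi.single (M := fun q => B (υ q)) q (e' (τ p) (υ q) a (M p q)) := by
    ext q
    change ∑ p', e (τ p') (υ q) (Pi.single (M := fun p => A (τ p)) p a p') (M p' q) = _
    rw [Finset.univ_sum_single, Finset.sum_eq_single p]
    · rw [Pi.single_eq_same]
      rfl
    · intro p' _ hp'
      rw [Pi.single_eq_of_ne hp', map_zero, LinearMap.zero_apply]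
    · simp
  rw [h2, map_sum] at h1
  rw [matrixCoeval_apply, LinearMap.sum_apply]
  exact h1

end Kronecker

/-! ## General elements of a vector space of linear maps -/

section General

variable {k : Type u} [Field k] {W : Type u} [AddCommGroup W] [Module k W]

theorem det_mem_polynomialFunctions {V : Type*} [AddCommGroup V] [Module k V]
    [FiniteDimensional k V] (g : W →ₗ[k] Module.End k V) :
    (fun w => LinearMap.det (g w)) ∈ polynomialFunctions k W := by
  let b := Module.finBasis k V
  have h1 : (fun w => LinearMap.det (g w)) =
      ∑ σ : Equiv.Perm (Fin (Module.finrank k V)), (Equiv.Perm.sign σ : ℤ) •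
        ∏ i, (((b.coord (σ i)) ∘ₗ (LinearMap.applyₗ (b i)) ∘ₗ g : Module.Dual k W) : W → k) := by
    ext w
    rw [← LinearMap.det_toMatrix b, Matrix.det_apply]
    simp [LinearMap.toMatrix_apply, Units.smul_def]
  rw [h1]
  refine Subalgebra.sum_mem _ fun σ _ => zsmul_mem (Subalgebra.prod_mem _ fun i _ => ?_) _
  exact Algebra.subset_adjoin ⟨_, rfl⟩

theorem holdsForGeneral_of_forall {p : W → Prop} (h : ∀ w, p w) : HoldsForGeneral k p :=
  ⟨Set.univ, ⟨{1}, Set.singleton_subset_iff.2 (one_mem _), by ext; simp⟩, Set.univ_nonempty,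
    fun w _ => h w⟩

theorem HoldsForGeneral.mono {p q : W → Prop} (hp : HoldsForGeneral k p) (h : ∀ w, p w → q w) :
    HoldsForGeneral k q :=
  let ⟨U, hU, hne, hUp⟩ := hp
  ⟨U, hU, hne, fun w hw => h w (hUp w hw)⟩

theorem holdsForGeneral_det_ne_zero {V : Type*} [AddCommGroup V] [Module k V]
    [FiniteDimensional k V] (g : W →ₗ[k] Module.End k V) {w₀ : W}
    (hw₀ : LinearMap.det (g w₀) ≠ 0) : HoldsForGeneral k fun w => LinearMap.det (g w) ≠ 0 := by
  refine ⟨_, ⟨{fun w => LinearMap.det (g w)}, ?_, rfl⟩, ⟨w₀, by simpa using hw₀⟩,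
    fun w hw => by simpa using hw⟩
  rw [Set.singleton_subset_iff]
  exact det_mem_polynomialFunctions g

theorem bijective_of_det_ne_zero {V : Type*} [AddCommGroup V] [Module k V]
    [FiniteDimensional k V] {f : Module.End k V} (hf : LinearMap.det f ≠ 0) :
    Function.Bijective f :=
  (Module.End.isUnit_iff f).1 ((LinearMap.isUnit_iff_isUnit_det f).2 (IsUnit.mk0 _ hf))

variable {U₁ U₂ : Type*} [AddCommGroup U₁] [Module k U₁] [AddCommGroup U₂] [Module k U₂]

/-- For a left inverse `g` of `f w₀`, the polynomial function `det (g ∘ f w)` is `1` at `w₀`, and `f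
w` is injective wherever it is nonzero. -/
theorem holdsForGeneral_injective [FiniteDimensional k U₁] (f : W →ₗ[k] U₁ →ₗ[k] U₂) {w₀ : W}
    (hw₀ : Function.Injective (f w₀)) : HoldsForGeneral k fun w => Function.Injective (f w) := by
  obtain ⟨g, hg⟩ := (f w₀).exists_leftInverse_of_injective (LinearMap.ker_eq_bot.2 hw₀)
  refine (holdsForGeneral_det_ne_zero (LinearMap.compRight k (M := U₁) g ∘ₗ f) (w₀ := w₀) ?_).mono
    fun w hw => ?_
  · change LinearMap.det (g ∘ₗ f w₀) ≠ 0
    rw [hg, LinearMap.det_id]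
    exact one_ne_zero
  · have h1 : Function.Bijective (g ∘ₗ f w) := bijective_of_det_ne_zero hw
    exact Function.Injective.of_comp (f := g) h1.1

theorem holdsForGeneral_surjective [FiniteDimensional k U₂] (f : W →ₗ[k] U₁ →ₗ[k] U₂) {w₀ : W}
    (hw₀ : Function.Surjective (f w₀)) : HoldsForGeneral k fun w => Function.Surjective (f w) := by
  obtain ⟨g, hg⟩ := (f w₀).exists_rightInverse_of_surjective (LinearMap.range_eq_top.2 hw₀)
  refine (holdsForGeneral_det_ne_zero (LinearMap.lcomp k U₂ g ∘ₗ f) (w₀ := w₀) ?_).mono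
    fun w hw => ?_
  · change LinearMap.det (f w₀ ∘ₗ g) ≠ 0
    rw [hg, LinearMap.det_id]
    exact one_ne_zero
  · have h1 : Function.Bijective (f w ∘ₗ g) := bijective_of_det_ne_zero hw
    exact Function.Surjective.of_comp (g := g) h1.2

end General

/-! ### Dimensions in `ℕ∞` and maximal rank -/

section Dimension

variable {k : Type u} [Field k] {W₁ W₂ : Type u} [AddCommGroup W₁] [Module k W₁]
  [AddCommGroup W₂] [Module k W₂]

theorem vdim_eq_finrank [FiniteDimensional k W₁] : vdim k W₁ = Module.finrank k W₁ := by
  rw [vdim, ← Module.finrank_eq_rank, Cardinal.toENat_nat]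

theorem vdim_eq_top (h : ¬ FiniteDimensional k W₁) : vdim k W₁ = ⊤ := by
  rw [vdim, Cardinal.toENat_eq_top, ← not_lt]
  exact fun h1 => h (Module.rank_lt_aleph0_iff.1 h1)

theorem HasMaximalRank.of_injective {f : W₁ →ₗ[k] W₂} (hf : Function.Injective f) :
    HasMaximalRank f := by
  have h1 : Module.rank k (LinearMap.range f) = Module.rank k W₁ :=
    (LinearEquiv.ofInjective f hf).symm.rank_eq
  rw [HasMaximalRank, vdim, vdim, vdim, h1, min_eq_left]
  exact Cardinal.toENat.monotone' (LinearMap.rank_le_of_injective f hf)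

theorem HasMaximalRank.of_surjective {f : W₁ →ₗ[k] W₂} (hf : Function.Surjective f) :
    HasMaximalRank f := by
  have h1 : Module.rank k (LinearMap.range f) = Module.rank k W₂ := rank_range_of_surjective f hf
  rw [HasMaximalRank, vdim, vdim, vdim, h1, min_eq_right]
  exact Cardinal.toENat.monotone' (LinearMap.rank_le_of_surjective f hf)

theorem exists_surjective_pi_of_not_finiteDimensional {V : Type*} [AddCommGroup V] [Module k V]
    (h : ¬ FiniteDimensional k V) (m : ℕ) :
    ∃ π : V →ₗ[k] (Fin m → k), Function.Surjective π := by
  have h1 : (m : Cardinal) ≤ Module.rank k V :=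
    Cardinal.natCast_le_aleph0.trans (not_lt.1 fun h1 => h (Module.rank_lt_aleph0_iff.1 h1))
  obtain ⟨v, hv⟩ := exists_linearIndependent_of_le_rank h1
  obtain ⟨π, hπ⟩ := (Fintype.linearCombination k v).exists_leftInverse_of_injective
    (LinearMap.ker_eq_bot.2 (hv.fintypeLinearCombination_injective))
  exact ⟨π, fun x => ⟨_, LinearMap.congr_fun hπ x⟩⟩

end Dimension

/-! ## Global sections of direct sums -/

section Sections

variable {n : ℕ} {k : Type u} [Field k]

theorem H0.map_comp {L M N : (PSpace n k).Modules} (φ : L ⟶ M) (ψ : M ⟶ N) (x : H0 L) :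
    H0.map (φ ≫ ψ) x = H0.map ψ (H0.map φ x) := rfl

theorem H0.map_id {M : (PSpace n k).Modules} (x : H0 M) : H0.map (𝟙 M) x = x := rfl

theorem ev_flip_apply {M N : (PSpace n k).Modules} (φ : M ⟶ N) : (ev M N).flip φ = H0.map φ := rfl

theorem H0.map_sum {M N : (PSpace n k).Modules} {ι : Type*} (s : Finset ι) (φ : ι → (M ⟶ N))
    (x : H0 M) : H0.map (∑ i ∈ s, φ i) x = ∑ i ∈ s, H0.map (φ i) x := by
  rw [← ev_flip_apply, _root_.map_sum, LinearMap.sum_apply]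
  rfl

variable {ι : Type} [Fintype ι] (X : ι → (PSpace n k).Modules)

/-- The sections of a direct sum are the families of sections of the summands. -/
noncomputable def H0.biproductEquiv : H0 (⨁ X) ≃ₗ[k] ∀ i, H0 (X i) :=
  LinearEquiv.ofBijective (LinearMap.pi fun i => H0.map (biproduct.π X i)) <| by
    classical
    refine ⟨(injective_iff_map_eq_zero _).2 fun x hx => ?_, fun y => ?_⟩
    · rw [← H0.map_id x, ← biproduct.total, H0.map_sum]
      refine Finset.sum_eq_zero fun i _ => ?_
      rw [H0.map_comp, show H0.map (biproduct.π X i) x = 0 from congrFun hx i, map_zero]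
    · refine ⟨∑ i, H0.map (biproduct.ι X i) (y i), funext fun j => ?_⟩
      rw [LinearMap.pi_apply, _root_.map_sum, Finset.sum_eq_single j]
      · rw [← H0.map_comp, biproduct.ι_π_self, H0.map_id]
      · intro i _ hij
        rw [← H0.map_comp, biproduct.ι_π_ne X hij, ← ev_flip_apply, map_zero, LinearMap.zero_apply]
      · simp

theorem H0.biproductEquiv_apply (x : H0 (⨁ X)) (i : ι) :
    H0.biproductEquiv X x i = H0.map (biproduct.π X i) x := rfl

theorem H0.biproductEquiv_map_matrix {κ : Type} [Fintype κ] (Y : κ → (PSpace n k).Modules)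
    (M : ∀ i j, X i ⟶ Y j) (x : H0 (⨁ X)) (j : κ) :
    H0.biproductEquiv Y (H0.map (biproduct.matrix M) x) j =
      ∑ i, H0.map (M i j) (H0.biproductEquiv X x i) := by
  rw [H0.biproductEquiv_apply, ← H0.map_comp, biproduct.matrix_π, biproduct.desc_eq, H0.map_sum]
  rfl

end Sections

/-! ## Strongly Kronecker stable pairs -/

section Stable

variable {n : ℕ} {k : Type u} [Field k] {E F : (PSpace n k).Modules}

theorem StronglyKroneckerStable.map₂_top (h : StronglyKroneckerStable E F) :
    Submodule.map₂ (ev E F) ⊤ ⊤ = ⊤ := by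
  rw [Submodule.map₂_eq_span_image2, eq_top_iff]
  rintro x -
  obtain ⟨t, rfl⟩ := h.ev_surjective x
  induction t with
  | zero => simp
  | tmul v φ => exact Submodule.subset_span ⟨v, trivial, φ, trivial, rfl⟩
  | add s t hs ht =>
    rw [map_add]
    exact Submodule.add_mem _ hs ht

/-- In an infinite-dimensional `H⁰(E)`, a complement of a line would be a proper nonzero subspace of
infinite dimension, and the smaller side of the stability inequality would be `⊤`. -/
theorem StronglyKroneckerStable.finiteDimensional (h : StronglyKroneckerStable E F) :
    FiniteDimensional k (H0 E) := by
  by_contra hE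
  have hne : Nontrivial (H0 E) := by
    by_contra hs
    rw [not_nontrivial_iff_subsingleton] at hs
    exact hE inferInstance
  obtain ⟨v, hv⟩ := exists_ne (0 : H0 E)
  obtain ⟨V, hV⟩ := Submodule.exists_isCompl (k ∙ v)
  have hVinf : ¬ FiniteDimensional k V := by
    intro hV'
    refine hE (Module.Finite.equiv (Submodule.prodEquivOfIsCompl _ _ hV))
  have h1 := h.dim_lt V ?_ ?_
  · rw [vdim_eq_top hVinf, ENat.top_mul h.h0_ne_zero] at h1
    exact not_top_lt h1
  · rintro rfl
    exact hVinf inferInstance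
  · rintro rfl
    have h2 := hV.disjoint.eq_bot
    rw [inf_top_eq, Submodule.span_singleton_eq_bot] at h2
    exact hv h2

theorem StronglyKroneckerStable.h0_ne_zero' (h : StronglyKroneckerStable E F) : h0 E ≠ 0 := by
  have := h.finiteDimensional
  intro h1
  rw [h0, vdim_eq_finrank, Nat.cast_eq_zero, Module.finrank_zero_iff] at h1
  have h2 := h.map₂_top
  have h3 : (⊤ : Submodule k (H0 E)) = ⊥ := Subsingleton.elim _ _
  rw [h3, Submodule.map₂_bot_left] at h2
  have h4 : Subsingleton (H0 F) :=
    (Submodule.subsingleton_iff k).1 (subsingleton_of_bot_eq_top h2)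
  refine h.h0_ne_zero ?_
  rw [h0, vdim_eq_finrank, Module.finrank_zero_of_subsingleton]
  rfl

/-- A proper nonzero `V` would make the smaller side of the stability inequality `⊤`. So `H⁰(E)` is
at most a line. -/
theorem StronglyKroneckerStable.eq_bot_or_eq_top (h : StronglyKroneckerStable E F)
    (hF : ¬ FiniteDimensional k (H0 F)) (V : Submodule k (H0 E)) : V = ⊥ ∨ V = ⊤ := by
  by_contra! hV
  have := h.finiteDimensional
  have h1 := h.dim_lt V hV.1 hV.2
  rw [h0, vdim_eq_top hF, ENat.mul_top] at h1
  · exact not_top_lt h1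
  · rw [vdim_eq_finrank, Nat.cast_ne_zero]
    exact fun h2 => hV.1 (Submodule.finrank_eq_zero.1 h2)

theorem StronglyKroneckerStable.finrank_lt (h : StronglyKroneckerStable E F)
    [FiniteDimensional k (H0 F)] (V : Submodule k (H0 E)) (hV : V ≠ ⊥) (hV' : V ≠ ⊤) :
    Module.finrank k V * Module.finrank k (H0 F) <
      Module.finrank k (Submodule.map₂ (ev E F) V ⊤) * Module.finrank k (H0 E) := by
  have := h.finiteDimensional
  have h1 := h.dim_lt V hV hV'
  rw [h0, h0, vdim_eq_finrank, vdim_eq_finrank, vdim_eq_finrank, vdim_eq_finrank] at h1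
  exact_mod_cast h1

end Stable

/-! ### From matrices of homomorphisms to morphisms of direct sums -/

section General

variable {n : ℕ} {k : Type u} [Field k] {I J P Q : Type} [Fintype P] [Fintype Q]
  (E : I → (PSpace n k).Modules) (F : J → (PSpace n k).Modules) (τ : P → I) (υ : Q → J)

theorem biproductEquiv_map_matrix_eq (M : ∀ q p, E (τ p) ⟶ F (υ q))
    (x : H0 (⨁ fun p => E (τ p))) :
    H0.biproductEquiv (fun q => F (υ q)) (H0.map (biproduct.matrix fun p q => M q p) x) =
      matrixEval (fun i j => ev (E i) (F j)) τ υ (H0.biproductEquiv (fun p => E (τ p)) x) M :=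
  funext fun q => H0.biproductEquiv_map_matrix _ _ _ x q

theorem holdsForGeneral_hasMaximalRank_of_injective [∀ i, FiniteDimensional k (H0 (E i))]
    (h : ∃ M : ∀ q p, E (τ p) ⟶ F (υ q), ∀ x : ∀ p, H0 (E (τ p)),
      matrixEval (fun i j => ev (E i) (F j)) τ υ x M = 0 → x = 0) :
    HoldsForGeneral k fun M : (⨁ fun p => E (τ p)) ⟶ (⨁ fun q => F (υ q)) =>
      HasMaximalRank (H0.map M) := by
  obtain ⟨M, hM⟩ := h
  have : FiniteDimensional k (H0 (⨁ fun p => E (τ p))) :=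
    Module.Finite.equiv (H0.biproductEquiv fun p => E (τ p)).symm
  refine (holdsForGeneral_injective (ev _ _).flip
    (w₀ := biproduct.matrix fun p q => M q p) ?_).mono fun _ hw => HasMaximalRank.of_injective hw
  refine (injective_iff_map_eq_zero _).2 fun x hx => ?_
  have h1 := biproductEquiv_map_matrix_eq E F τ υ M x
  rw [show H0.map (biproduct.matrix fun p q => M q p) x = 0 from hx, map_zero] at h1
  exact (LinearEquiv.map_eq_zero_iff _).1 (hM _ h1.symm)

theorem holdsForGeneral_hasMaximalRank_of_surjective [∀ j, FiniteDimensional k (H0 (F j))]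
    (h : ∃ M : ∀ q p, E (τ p) ⟶ F (υ q), ∀ z, ∃ x : ∀ p, H0 (E (τ p)),
      matrixEval (fun i j => ev (E i) (F j)) τ υ x M = z) :
    HoldsForGeneral k fun M : (⨁ fun p => E (τ p)) ⟶ (⨁ fun q => F (υ q)) =>
      HasMaximalRank (H0.map M) := by
  obtain ⟨M, hM⟩ := h
  have : FiniteDimensional k (H0 (⨁ fun q => F (υ q))) :=
    Module.Finite.equiv (H0.biproductEquiv fun q => F (υ q)).symm
  refine (holdsForGeneral_surjective (ev _ _).flip
    (w₀ := biproduct.matrix fun p q => M q p) ?_).mono fun _ hw => HasMaximalRank.of_surjective hw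
  intro z
  obtain ⟨x, hx⟩ := hM (H0.biproductEquiv (fun q => F (υ q)) z)
  refine ⟨(H0.biproductEquiv fun p => E (τ p)).symm x,
    (H0.biproductEquiv fun q => F (υ q)).injective ?_⟩
  have h1 := biproductEquiv_map_matrix_eq E F τ υ M ((H0.biproductEquiv fun p => E (τ p)).symm x)
  rw [LinearEquiv.apply_symm_apply, hx] at h1
  exact h1

theorem h0_biproduct [∀ i, FiniteDimensional k (H0 (E i))] :
    h0 (⨁ fun p => E (τ p)) = (∑ p, Module.finrank k (H0 (E (τ p))) : ℕ) := by
  rw [h0, vdim, (H0.biproductEquiv fun p => E (τ p)).rank_eq, ← Module.finrank_eq_rank,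
    Cardinal.toENat_nat, Module.finrank_pi_fintype]

end General

/-! ## The theorem -/

section Main

variable {n : ℕ} {k : Type u} [Field k] [Infinite k] {a b : ℕ}
  {E : Fin a → (PSpace n k).Modules} {F : Fin b → (PSpace n k).Modules}

theorem holdsForGeneral_hasMaximalRank_of_finiteDimensional [Nonempty (Fin a)] [Nonempty (Fin b)]
    [∀ i, FiniteDimensional k (H0 (E i))] [∀ j, FiniteDimensional k (H0 (F j))]
    (hEF : ∀ i j, StronglyKroneckerStable (E i) (F j)) (s : Fin a → ℕ) (t : Fin b → ℕ)
    (hmax : (⨆ i, h0 (E i)) * (⨆ j, h0 (F j)) * ∑ i, h0 (E i) ^ 2 ≤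
      4 * max (h0 (sumOfPowers E s)) (h0 (sumOfPowers F t))) :
    HoldsForGeneral k fun M : sumOfPowers E s ⟶ sumOfPowers F t => HasMaximalRank (H0.map M) := by
  let τ : (Σ i, Fin (s i)) → Fin a := Sigma.fst
  let υ : (Σ j, Fin (t j)) → Fin b := Sigma.fst
  let α := Finset.univ.sup fun i => Module.finrank k (H0 (E i))
  let β := Finset.univ.sup fun j => Module.finrank k (H0 (F j))
  have hα : ∀ i, Module.finrank k (H0 (E i)) ≤ α := fun i =>
    Finset.le_sup (f := fun i => Module.finrank k (H0 (E i))) (Finset.mem_univ i)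
  have hβ : ∀ j, Module.finrank k (H0 (F j)) ≤ β := fun j =>
    Finset.le_sup (f := fun j => Module.finrank k (H0 (F j))) (Finset.mem_univ j)
  have hhE : ∀ i, h0 (E i) = Module.finrank k (H0 (E i)) := fun i => vdim_eq_finrank
  have hhF : ∀ j, h0 (F j) = Module.finrank k (H0 (F j)) := fun j => vdim_eq_finrank
  have hα' : (α : ℕ∞) ≤ ⨆ i, h0 (E i) := by
    obtain ⟨i, -, hi⟩ := Finset.exists_mem_eq_sup Finset.univ Finset.univ_nonempty
      fun i => Module.finrank k (H0 (E i))
    change ((Finset.univ.sup _ : ℕ) : ℕ∞) ≤ _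
    rw [hi, ← hhE]
    exact le_iSup (fun i => h0 (E i)) i
  have hβ' : (β : ℕ∞) ≤ ⨆ j, h0 (F j) := by
    obtain ⟨j, -, hj⟩ := Finset.exists_mem_eq_sup Finset.univ Finset.univ_nonempty
      fun j => Module.finrank k (H0 (F j))
    change ((Finset.univ.sup _ : ℕ) : ℕ∞) ≤ _
    rw [hj, ← hhF]
    exact le_iSup (fun j => h0 (F j)) j
  have hβ0 : β ≠ 0 := by
    obtain ⟨i⟩ := ‹Nonempty (Fin a)›
    obtain ⟨j⟩ := ‹Nonempty (Fin b)›
    intro h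
    refine (hEF i j).h0_ne_zero ?_
    rw [hhF, Nat.cast_eq_zero]
    exact Nat.le_zero.1 (h ▸ hβ j)
  have hmaxN : α * β * ∑ i, Module.finrank k (H0 (E i)) ^ 2 ≤
      4 * max (∑ p, Module.finrank k (H0 (E (τ p)))) (∑ q, Module.finrank k (H0 (F (υ q)))) := by
    have h1 : h0 (sumOfPowers E s) = (∑ p, Module.finrank k (H0 (E (τ p))) : ℕ) :=
      h0_biproduct E τ
    have h2 : h0 (sumOfPowers F t) = (∑ q, Module.finrank k (H0 (F (υ q))) : ℕ) :=
      h0_biproduct F υ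
    rw [h1, h2, ← Nat.mono_cast.map_max] at hmax
    have h3 : (α : ℕ∞) * β * ∑ i, h0 (E i) ^ 2 ≤ _ :=
      (mul_le_mul_left (mul_le_mul' hα' hβ') _).trans hmax
    simp only [hhE] at h3
    exact_mod_cast h3
  have hst := sum_mul_sub_add_min_le_of_stable (fun i j => ev (E i) (F j)) τ υ
    (fun i j K h1 h2 => (hEF i j).finrank_lt K h1 h2) α β hα hβ hβ0 hmaxN
  rcases le_total (∑ p, Module.finrank k (H0 (E (τ p)))) (∑ q, Module.finrank k (H0 (F (υ q))))
    with h | h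
  · refine holdsForGeneral_hasMaximalRank_of_injective E F τ υ
      (exists_matrixEval_injective_of_le _ υ (fun i j => (hEF i j).map₂_top) h
        fun K hK hK0 => ?_)
    have h1 := hst K hK hK0
    rw [min_eq_left h] at h1
    change _ + ∑ p, Module.finrank k (K (τ p)) ≤ _
    omega
  · refine holdsForGeneral_hasMaximalRank_of_surjective E F τ υ
      (exists_matrixEval_surjective_of_le _ τ υ (fun i j => (hEF i j).map₂_top) h
        fun K hK hK0 => ?_)
    have h1 := hst K hK hK0
    rwa [min_eq_right h] at h1

/-- The map can be made injective: `H⁰(F j₀)` is projected onto a space of dimension `U₁` and the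
other `H⁰(F j)` to zero, so that the target is finite-dimensional yet large enough. Since the `H⁰(E
i)` have no proper nonzero subspaces, the numerical condition is vacuous, and injectivity after
projection implies injectivity before it. -/
theorem holdsForGeneral_hasMaximalRank_of_not_finiteDimensional [Nonempty (Fin a)]
    (hEF : ∀ i j, StronglyKroneckerStable (E i) (F j)) (s : Fin a → ℕ) (t : Fin b → ℕ)
    [∀ i, FiniteDimensional k (H0 (E i))] {j₀ : Fin b} (hj₀ : ¬ FiniteDimensional k (H0 (F j₀)))
    (ht : t j₀ ≠ 0) :
    HoldsForGeneral k fun M : sumOfPowers E s ⟶ sumOfPowers F t => HasMaximalRank (H0.map M) := by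
  classical
  let τ : (Σ i, Fin (s i)) → Fin a := Sigma.fst
  let υ : (Σ j, Fin (t j)) → Fin b := Sigma.fst
  let m : Fin b → ℕ := fun j => if j = j₀ then ∑ p, Module.finrank k (H0 (E (τ p))) else 0
  have hπ : ∀ j, ∃ π : H0 (F j) →ₗ[k] (Fin (m j) → k), Function.Surjective π := by
    intro j
    by_cases h : j = j₀
    · subst h
      exact exists_surjective_pi_of_not_finiteDimensional hj₀ _
    · have : IsEmpty (Fin (m j)) := by
        rw [show m j = 0 from if_neg h]
        infer_instance
      exact ⟨0, fun x => ⟨0, Subsingleton.elim _ _⟩⟩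
  choose π hπ using hπ
  refine holdsForGeneral_hasMaximalRank_of_injective E F τ υ ?_
  have key : ∃ M : ∀ q p, E (τ p) ⟶ F (υ q), ∀ x : ∀ p, H0 (E (τ p)),
      matrixEval (fun i j => (ev (E i) (F j)).compr₂ (π j)) τ υ x M = 0 → x = 0 := by
    refine exists_matrixEval_injective_of_le (s := s)
      (fun i j => (ev (E i) (F j)).compr₂ (π j)) υ (fun i j => ?_) ?_ ?_
    · rw [← Submodule.map_map₂, (hEF i j).map₂_top, Submodule.map_top,
        LinearMap.range_eq_top.2 (hπ j)]
    · let q₀ : Σ j, Fin (t j) := ⟨j₀, ⟨0, Nat.pos_of_ne_zero ht⟩⟩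
      refine le_trans (le_of_eq ?_) (Finset.single_le_sum
        (f := fun q => Module.finrank k (Fin (m (υ q)) → k)) (fun _ _ => Nat.zero_le _)
        (Finset.mem_univ q₀))
      rw [Module.finrank_pi, Fintype.card_fin]
      exact (if_pos rfl).symm
    · rintro K hK ⟨i, hi⟩
      exact (((hEF i j₀).eq_bot_or_eq_top hj₀ (K i)).elim hi (hK i)).elim
  obtain ⟨M, hM⟩ := key
  refine ⟨M, fun x hx => hM x (funext fun q => ?_)⟩
  have h1 := congrArg (π (υ q)) (congrFun hx q)
  rw [matrixEval_apply, map_sum] at h1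
  exact h1.trans (map_zero _)

end Main

end MaxRank

theorem theorem2p5 {k : Type u} [Field k] [IsAlgClosed k] (n : ℕ) {a b : ℕ}
    (E : Fin a → (MaxRank.PSpace n k).Modules) (F : Fin b → (MaxRank.PSpace n k).Modules)
    (hE : ∀ i, MaxRank.IsCoherent (E i)) (hF : ∀ j, MaxRank.IsCoherent (F j))
    (hEF : ∀ i j, MaxRank.StronglyKroneckerStable (E i) (F j))
    (s : Fin a → ℕ) (t : Fin b → ℕ)
    (hmax : (⨆ i, MaxRank.h0 (E i)) * (⨆ j, MaxRank.h0 (F j)) * ∑ i, MaxRank.h0 (E i) ^ 2 ≤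
      4 * max (MaxRank.h0 (MaxRank.sumOfPowers E s)) (MaxRank.h0 (MaxRank.sumOfPowers F t))) :
    MaxRank.HoldsForGeneral k
      (fun M : MaxRank.sumOfPowers E s ⟶ MaxRank.sumOfPowers F t =>
        MaxRank.HasMaximalRank (MaxRank.H0.map M)) := by
  have : Infinite k := IsAlgClosed.instInfinite
  rcases isEmpty_or_nonempty (Fin b) with hb | ⟨⟨j₁⟩⟩
  · refine MaxRank.holdsForGeneral_of_forall fun M => MaxRank.HasMaximalRank.of_surjective ?_
    have : Subsingleton (MaxRank.H0 (MaxRank.sumOfPowers F t)) :=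
      (MaxRank.H0.biproductEquiv fun q : Σ j, Fin (t j) => F q.1).toEquiv.subsingleton
    exact fun x => ⟨0, Subsingleton.elim _ _⟩
  rcases isEmpty_or_nonempty (Fin a) with ha | ⟨⟨i₁⟩⟩
  · refine MaxRank.holdsForGeneral_of_forall fun M => MaxRank.HasMaximalRank.of_injective ?_
    have : Subsingleton (MaxRank.H0 (MaxRank.sumOfPowers E s)) :=
      (MaxRank.H0.biproductEquiv fun p : Σ i, Fin (s i) => E p.1).toEquiv.subsingleton
    exact Function.injective_of_subsingleton _
  have : Nonempty (Fin a) := ⟨i₁⟩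
  have : Nonempty (Fin b) := ⟨j₁⟩
  have hfinE : ∀ i, FiniteDimensional k (MaxRank.H0 (E i)) := fun i =>
    (hEF i j₁).finiteDimensional
  by_cases hfinF : ∀ j, FiniteDimensional k (MaxRank.H0 (F j))
  · exact MaxRank.holdsForGeneral_hasMaximalRank_of_finiteDimensional hEF s t hmax
  push Not at hfinF
  obtain ⟨j₂, hj₂⟩ := hfinF
  by_cases hex : ∃ j, ¬ FiniteDimensional k (MaxRank.H0 (F j)) ∧ t j ≠ 0
  · obtain ⟨j₀, hj₀, ht⟩ := hex
    exact MaxRank.holdsForGeneral_hasMaximalRank_of_not_finiteDimensional hEF s t hj₀ ht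
  -- Now every `F j` with infinite-dimensional sections has multiplicity `0`. The left side of
  -- `hmax` is then `⊤`, while both direct sums have finite `h⁰`: a contradiction.
  push Not at hex
  have hfin : ∀ q : Σ j, Fin (t j), FiniteDimensional k (MaxRank.H0 (F q.1)) := fun q => by
    by_contra h
    exact (hex q.1 h ▸ q.2).elim0
  have h1 : MaxRank.h0 (MaxRank.sumOfPowers E s) ≠ ⊤ := by
    rw [show MaxRank.h0 (MaxRank.sumOfPowers E s) = _ from
      MaxRank.h0_biproduct E (Sigma.fst : (Σ i, Fin (s i)) → Fin a)]
    exact ENat.natCast_ne_top _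
  have h2 : MaxRank.h0 (MaxRank.sumOfPowers F t) ≠ ⊤ := by
    rw [show MaxRank.h0 (MaxRank.sumOfPowers F t) = _ from
      MaxRank.h0_biproduct (fun q : Σ j, Fin (t j) => F q.1) id]
    exact ENat.natCast_ne_top _
  have h3 : ⨆ j, MaxRank.h0 (F j) = ⊤ :=
    top_le_iff.1 ((MaxRank.vdim_eq_top hj₂).symm.le.trans (le_iSup (fun j => MaxRank.h0 (F j)) j₂))
  have h4 : MaxRank.h0 (E i₁) ≠ 0 := (hEF i₁ j₁).h0_ne_zero'
  have h5 : ⨆ i, MaxRank.h0 (E i) ≠ 0 := fun h =>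
    h4 (le_antisymm (h ▸ le_iSup (fun i => MaxRank.h0 (E i)) i₁) bot_le)
  have h6 : ∑ i, MaxRank.h0 (E i) ^ 2 ≠ 0 := fun h =>
    pow_ne_zero 2 h4 (Finset.sum_eq_zero_iff.1 h i₁ (Finset.mem_univ _))
  rw [h3, ENat.mul_top h5, ENat.top_mul h6, top_le_iff] at hmax
  have h7 : max (MaxRank.h0 (MaxRank.sumOfPowers E s))
      (MaxRank.h0 (MaxRank.sumOfPowers F t)) ≠ ⊤ := by
    rcases max_choice (MaxRank.h0 (MaxRank.sumOfPowers E s))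
      (MaxRank.h0 (MaxRank.sumOfPowers F t)) with h | h <;> rw [h] <;> assumption
  obtain ⟨N, hN⟩ := ENat.ne_top_iff_exists.1 h7
  rw [← hN] at hmax
  exact (ENat.natCast_ne_top (4 * N) (by exact_mod_cast hmax)).elim
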